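/- Let $X$ be a connected smooth manifold (Hausdorff, second countable, without boundary), let $x\in X$, and let $Q$ be a finite quiver. For a category $\mathcal C$, let $\mathrm{Rep}(Q,\mathcal C)$ be the category of representations of $Q$ in $\mathcal C$: an object is a family of objects $V_i$ of $\mathcal C$ indexed by the vertices $i$ of $Q$ together with a morphism $\phi_a\colon V_{s(a)}\to V_{t(a)}$ for each arrow $a$, and a morphism $(V,\phi)\to(W,\psi)$ is a family of morphisms $f_i\colon V_i\to W_i$ with $f_{t(a)}\circ\phi_a=\psi_a\circ f_{s(a)}$ for every arrow $a$. For a group $G$, let $\mathrm{Rep}(G,\mathcal C)$ be the category whose objects are pairs $(V,\rho)$ of an object $V$ of $\mathcal C$ and a group homomorphism $\rho\colon G\to\mathrm{Aut}_{\mathcal C}(V)$, and whose morphisms $(V_1,\rho_1)\to(V_2,\rho_2)$ are the morphisms $f\colon V_1\to V_2$ of $\mathcal C$ with $f\circ\rho_1(g)=\rho_2(g)\circ f$ for all $g\in G$. Let $\mathbf{VSpace}$ be the category of finite-dimensional real vector spaces, and let $\mathbf{VB}(X)^{\mathrm F}$ be the category of flat vector bundles on $X$: an object is a smooth real vector bundle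 $\mathcal E$ of finite rank on $X$ with a smooth connection $\nabla$ of zero curvature, and a morphism $(\mathcal E,\nabla)\to(\mathcal E',\nabla')$ is a morphism of smooth vector bundles $\varphi\colon\mathcal E\to\mathcal E'$ over $\mathrm{id}_X$ with $\nabla'\circ\varphi=(\mathrm{id}_{T^*_X}\otimes\varphi)\circ\nabla$. Then there is an equivalence of categories $$\mathrm{Rep}\big(Q,\mathbf{VB}(X)^{\mathrm F}\big)\;\simeq\;\mathrm{Rep}\big(\pi_1(X,x),\mathrm{Rep}(Q,\mathbf{VSpace})\big),$$ that is, the category of flat $Q$-bundles on $X$ is equivalent to the category of representations of $\pi_1(X,x)$ in the category of finite-dimensional real representations of $Q$. -/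

import Mathlib

open CategoryTheory Bundle
open scoped Manifold ContDiff

universe u v w w'

/-! ### Representations of a quiver in a category -/

/-- A representation of the quiver `Q` in the category `C`: an object for every vertex and a
morphism for every arrow. -/
structure QuiverRep (Q : Type w) [Quiver.{w'} Q] (C : Type*) [Category* C] where
  /-- The object at a vertex. -/
  obj : Q → C
  /-- The morphism along an arrow. -/
  map : ∀ {i j : Q}, (i ⟶ j) → (obj i ⟶ obj j)

namespace QuiverRep

variable {Q : Type w} [Quiver.{w'} Q] {C : Type*} [Category* C]

/-- A morphism of representations of `Q`: a family of morphisms indexed by the vertices, making the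
square of every arrow commute. -/
@[ext]
structure Hom (V W : QuiverRep Q C) where
  /-- The component at a vertex. -/
  app : ∀ i : Q, V.obj i ⟶ W.obj i
  comm : ∀ {i j : Q} (a : i ⟶ j), V.map a ≫ app j = app i ≫ W.map a

/-- The category `Rep(Q, C)`. -/
instance : Category (QuiverRep Q C) where
  Hom V W := Hom V W
  id V := { app := fun i => 𝟙 (V.obj i), comm := fun a => by simp }
  comp f g :=
    { app := fun i => f.app i ≫ g.app i
      comm := fun a => by
        rw [← Category.assoc, f.comm a, Category.assoc, g.comm a, Category.assoc] }
  id_comp f := Hom.ext (funext fun _ => Category.id_comp _)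
  comp_id f := Hom.ext (funext fun _ => Category.comp_id _)
  assoc f g h := Hom.ext (funext fun _ => Category.assoc _ _ _)

end QuiverRep

/-! ### Smooth vector bundles and flat connections on a smooth manifold -/

/-- A smooth real vector bundle of finite rank over the `d`-dimensional smooth manifold `X`. -/
structure SmoothVB (d : ℕ) (X : Type u) [TopologicalSpace X]
    [ChartedSpace (EuclideanSpace ℝ (Fin d)) X] [IsManifold (𝓡 d) ∞ X] where
  /-- The rank of the bundle. -/
  rank : ℕ
  /-- The fibres of the bundle. -/
  fiber : X → Type v
  [addCommGroup : ∀ y, AddCommGroup (fiber y)]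
  [module : ∀ y, Module ℝ (fiber y)]
  [topFiber : ∀ y, TopologicalSpace (fiber y)]
  [topAddGroup : ∀ y, IsTopologicalAddGroup (fiber y)]
  [continuousSMul : ∀ y, ContinuousSMul ℝ (fiber y)]
  [topTotal : TopologicalSpace (TotalSpace (EuclideanSpace ℝ (Fin rank)) fiber)]
  [fiberBundle : FiberBundle (EuclideanSpace ℝ (Fin rank)) fiber]
  [vectorBundle : VectorBundle ℝ (EuclideanSpace ℝ (Fin rank)) fiber]
  [smoothBundle : ContMDiffVectorBundle ∞ (EuclideanSpace ℝ (Fin rank)) fiber (𝓡 d)]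

namespace SmoothVB

attribute [instance] addCommGroup module topFiber topAddGroup continuousSMul topTotal fiberBundle
  vectorBundle smoothBundle

variable {d : ℕ} {X : Type u} [TopologicalSpace X]
    [ChartedSpace (EuclideanSpace ℝ (Fin d)) X] [IsManifold (𝓡 d) ∞ X]

/-- The model fibre `ℝ^rank` of a vector bundle. -/
abbrev model (E : SmoothVB.{u, v} d X) : Type := EuclideanSpace ℝ (Fin E.rank)

/-- The total space of a vector bundle. -/
abbrev Total (E : SmoothVB.{u, v} d X) : Type (max u v) := TotalSpace E.model E.fiber

/-- A section `σ` of `E` is smooth. -/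
def IsSmoothSection (E : SmoothVB.{u, v} d X) (σ : ∀ y, E.fiber y) : Prop :=
  ContMDiff (𝓡 d) ((𝓡 d).prod 𝓘(ℝ, E.model)) ∞ (fun y => (⟨y, σ y⟩ : E.Total))

/-- A vector field on `X` is smooth. -/
def IsSmoothVectorField (Y : ∀ y : X, TangentSpace (𝓡 d) y) : Prop :=
  ContMDiff (𝓡 d) (𝓡 d).tangent ∞ (fun y => (⟨y, Y y⟩ : TangentBundle (𝓡 d) X))

/-- A morphism of smooth vector bundles over `X`: a fibrewise linear map over the identity of `X`
which is smooth as a map of total spaces. -/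
@[ext]
structure Hom (E E' : SmoothVB.{u, v} d X) where
  /-- The linear map on each fibre. -/
  app : ∀ y, E.fiber y →L[ℝ] E'.fiber y
  smooth : ContMDiff ((𝓡 d).prod 𝓘(ℝ, E.model)) ((𝓡 d).prod 𝓘(ℝ, E'.model)) ∞
    (fun p : E.Total => (⟨p.1, app p.1 p.2⟩ : E'.Total))

/-- The category `VB(X)` of smooth vector bundles over `X`. -/
instance : Category (SmoothVB.{u, v} d X) where
  Hom E E' := Hom E E'
  id E := { app := fun y => ContinuousLinearMap.id ℝ (E.fiber y), smooth := contMDiff_id }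
  comp f g :=
    { app := fun y => (g.app y).comp (f.app y)
      smooth := g.smooth.comp f.smooth }

/-- A connection `∇` on `E` is flat if its curvature
`R(Y, Z) σ = ∇_Y ∇_Z σ - ∇_Z ∇_Y σ - ∇_[Y, Z] σ` vanishes. Here `∇ σ y (Y y)` is the value of
`∇_Y σ` at the point `y`. -/
def IsFlat (E : SmoothVB.{u, v} d X) (nabla : CovariantDerivative (𝓡 d) E.model E.fiber) : Prop :=
  ∀ Y Z : ∀ y : X, TangentSpace (𝓡 d) y, IsSmoothVectorField Y → IsSmoothVectorField Z →
    ∀ σ : ∀ y, E.fiber y, E.IsSmoothSection σ → ∀ y : X,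
      nabla (fun z => nabla σ z (Z z)) y (Y y) - nabla (fun z => nabla σ z (Y z)) y (Z y)
        - nabla σ y (VectorField.mlieBracket (𝓡 d) Y Z y) = 0

end SmoothVB

/-- A flat vector bundle over `X`: a smooth vector bundle with a smooth flat connection. -/
structure FlatVB (d : ℕ) (X : Type u) [TopologicalSpace X]
    [ChartedSpace (EuclideanSpace ℝ (Fin d)) X] [IsManifold (𝓡 d) ∞ X] where
  /-- The underlying smooth vector bundle. -/
  bundle : SmoothVB.{u, v} d X
  /-- The connection. -/
  nabla : CovariantDerivative (𝓡 d) bundle.model bundle.fiber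
  smooth : CovariantDerivative.ContMDiffCovariantDerivative nabla ∞
  flat : bundle.IsFlat nabla

namespace FlatVB

variable {d : ℕ} {X : Type u} [TopologicalSpace X]
    [ChartedSpace (EuclideanSpace ℝ (Fin d)) X] [IsManifold (𝓡 d) ∞ X]

/-- A morphism of flat vector bundles: a morphism `φ` of smooth vector bundles compatible with the
connections, `∇' (φ σ) = (id ⊗ φ) (∇ σ)` for all smooth sections `σ`. -/
@[ext]
structure Hom (E E' : FlatVB.{u, v} d X) where
  /-- The underlying morphism of vector bundles. -/
  hom : E.bundle ⟶ E'.bundle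
  compatible : ∀ σ : ∀ y, E.bundle.fiber y, E.bundle.IsSmoothSection σ → ∀ y : X,
    E'.nabla (fun z => hom.app z (σ z)) y = (hom.app y).comp (E.nabla σ y)

/-- The category `VB(X)^F` of flat vector bundles over `X`. -/
instance : Category (FlatVB.{u, v} d X) where
  Hom E E' := Hom E E'
  id E := { hom := 𝟙 E.bundle, compatible := fun _ _ _ => rfl }
  comp f g :=
    { hom := f.hom ≫ g.hom
      compatible := fun σ hσ y => by
        have h := g.compatible (fun z => f.hom.app z (σ z)) (f.hom.smooth.comp hσ) y
        rw [f.compatible σ hσ y] at h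
        exact h }

end FlatVB

/-!
A flat connection has local frames of parallel sections: in a chart centred at a point, solve the
linear differential equation of parallel transport along the radii; since the curvature vanishes,
the resulting radial gauge satisfies the whole system `dg = -A g` and not only its radial part.
Transition maps between parallel frames have zero derivative, hence are locally constant, so that a
flat bundle is the same as a local system of vector spaces. The morphisms of flat bundles are the
families of linear maps which are locally constant in parallel frames.

A local system is a bundle with discrete fibre, hence a covering space, and lifting paths turns it
into a representation of the fundamental groupoid. Restriction to the loops at `x` is faithful and
full because every point is joined to `x`. Conversely, a representation of the fundamental
groupoid gives a local system, trivialized over simply connected neighbourhoods by transport to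
their centres, whose locally constant transition maps glue to a flat bundle. This monodromy
equivalence is applied vertexwise to representations of `Q`, and a representation of `Q` in
representations of a group is a representation of that group in representations of `Q`.
-/

open Set Topology

/-! ### Representations of the fundamental groupoid -/

section Paths

variable {X : Type*} [TopologicalSpace X]

theorem pathHomotopicQuotient_induction_of_cover {U : X → Set X} (hU : ∀ c, IsOpen (U c))
    (hmem : ∀ c, c ∈ U c) {P : ∀ {y z : X}, Path.Homotopic.Quotient y z → Prop}
    (htrans : ∀ {a b c : X} (p : Path.Homotopic.Quotient a b) (q : Path.Homotopic.Quotient b c),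
      P p → P q → P (p.trans q))
    (hshort : ∀ c {y z : X} (γ : Path y z), range γ ⊆ U c → P (.mk γ))
    {y z : X} (γ : Path.Homotopic.Quotient y z) : P γ := by
  obtain ⟨γ, rfl⟩ := Path.Homotopic.Quotient.mk_surjective γ
  obtain ⟨t, ht0, ht_mono, ⟨n, hn⟩, ht⟩ :=
    exists_monotone_Icc_subset_open_cover_unitInterval (c := fun c => γ ⁻¹' U c)
      (fun c => (hU c).preimage γ.continuous) (fun s _ => mem_iUnion.2 ⟨γ s, hmem (γ s)⟩)
  have initial_piece (k : ℕ) : P (.mk (γ.subpath (t 0) (t k))) := by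
    induction k with
    | zero =>
      refine hshort (γ (t 0)) _ ?_
      rw [Path.subpath_self]
      rintro _ ⟨s, rfl⟩
      exact hmem _
    | succ k ih =>
      obtain ⟨c, hc⟩ := ht k
      have hstep : P (.mk (γ.subpath (t k) (t (k + 1)))) := by
        refine hshort c _ ?_
        rw [Path.range_subpath_of_le _ _ _ (ht_mono (Nat.le_succ k))]
        exact image_subset_iff.2 hc
      have hconcat := htrans _ _ ih hstep
      rwa [← Path.Homotopic.Quotient.mk_trans,
        Path.Homotopic.Quotient.eq.2 ⟨Path.Homotopy.subpathTransSubpath γ _ _ _⟩] at hconcat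
  have of_cast : ∀ {a b : X} (ha : a = y) (hb : b = z), P (.mk (γ.cast ha hb)) → P (.mk γ) := by
    rintro _ _ rfl rfl h
    exact h
  have hγ := initial_piece n
  rw [hn n le_rfl, ht0, Path.subpath_zero_one] at hγ
  exact of_cast _ _ hγ

theorem path_apply_eq_of_eventually_eq {α : Type*} {y z : X} (γ : Path y z) {f : X → α}
    (hf : ∀ w ∈ range γ, ∀ᶠ w' in 𝓝 w, f w' = f w) : f y = f z := by
  have h : IsLocallyConstant (fun t => f (γ t)) := by
    rw [IsLocallyConstant.iff_eventually_eq]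
    exact fun t => γ.continuous.continuousAt.eventually (hf (γ t) ⟨t, rfl⟩)
  simpa only [γ.source, γ.target] using h.apply_eq_of_preconnectedSpace 0 1

theorem eventually_exists_path_range_subset [LocallyPathConnectedSpace X] {U : Set X} {y : X}
    (hU : U ∈ 𝓝 y) : ∀ᶠ z in 𝓝 y, ∃ γ : Path y z, range γ ⊆ U := by
  obtain ⟨N, ⟨hN, hN_conn⟩, hNU⟩ := (path_connected_basis y).mem_iff.1 hU
  filter_upwards [hN] with z hz
  obtain ⟨γ, hγ⟩ := hN_conn.joinedIn y (mem_of_mem_nhds hN) z hz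
  exact ⟨γ, range_subset_iff.2 fun t => hNU (hγ t)⟩

end Paths

/-- A linear representation of the fundamental groupoid of `X` on the family of modules `V`, given
by its action on homotopy classes of paths. -/
structure PathTransport (R : Type*) [Semiring R] {X : Type*} [TopologicalSpace X] (V : X → Type*)
    [∀ y, AddCommMonoid (V y)] [∀ y, Module R (V y)] where
  /-- The linear map attached to a homotopy class of paths. -/
  map {y z : X} : Path.Homotopic.Quotient y z → V y →ₗ[R] V z
  map_refl (y : X) (v : V y) : map (.refl y) v = v
  map_trans {y z w : X} (γ : Path.Homotopic.Quotient y z) (γ' : Path.Homotopic.Quotient z w)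
    (v : V y) : map (γ.trans γ') v = map γ' (map γ v)

namespace PathTransport

variable {R : Type*} [CommSemiring R] {X : Type*} [TopologicalSpace X]
  {V : X → Type*} [∀ y, AddCommMonoid (V y)] [∀ y, Module R (V y)] (P : PathTransport R V)
  {V' : X → Type*} [∀ y, AddCommMonoid (V' y)] [∀ y, Module R (V' y)] (P' : PathTransport R V')

theorem map_symm_map {y z : X} (γ : Path.Homotopic.Quotient y z) (v : V y) :
    P.map γ.symm (P.map γ v) = v := by
  rw [← P.map_trans, Path.Homotopic.Quotient.trans_symm, P.map_refl]

theorem map_map_symm {y z : X} (γ : Path.Homotopic.Quotient y z) (v : V z) :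
    P.map γ (P.map γ.symm v) = v := by
  rw [← P.map_trans, Path.Homotopic.Quotient.symm_trans, P.map_refl]

/-- Transport along a homotopy class of paths as a linear isomorphism. -/
def equiv {y z : X} (γ : Path.Homotopic.Quotient y z) : V y ≃ₗ[R] V z :=
  { P.map γ with
    invFun := P.map γ.symm
    left_inv := P.map_symm_map γ
    right_inv := P.map_map_symm γ }

theorem equiv_apply {y z : X} (γ : Path.Homotopic.Quotient y z) (v : V y) :
    P.equiv γ v = P.map γ v := rfl

/-- The holonomy representation of the fundamental group at `x` on the module over `x`. -/
def holonomy (x : X) : Representation R (FundamentalGroup X x) (V x) where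
  toFun g := P.map g.toPath
  map_one' := LinearMap.ext (P.map_refl x)
  map_mul' g h := LinearMap.ext (P.map_trans h.toPath g.toPath)

theorem holonomy_apply {x : X} (γ : Path.Homotopic.Quotient x x) (v : V x) :
    P.holonomy x (FundamentalGroup.fromPath γ) v = P.map γ v := rfl

/-- A family of linear maps is natural if it commutes with transport. -/
def IsNatural (φ : ∀ y, V y →ₗ[R] V' y) : Prop :=
  ∀ ⦃y z : X⦄ (γ : Path.Homotopic.Quotient y z) (v : V y), φ z (P.map γ v) = P'.map γ (φ y v)

variable {P P'}

theorem IsNatural.isIntertwiningMap {φ : ∀ y, V y →ₗ[R] V' y} (hφ : P.IsNatural P' φ) (x : X) :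
    (P.holonomy x).IsIntertwiningMap (P'.holonomy x) (φ x) :=
  ⟨fun g v => hφ g.toPath v⟩

theorem IsNatural.ext [PathConnectedSpace X] {φ ψ : ∀ y, V y →ₗ[R] V' y} (hφ : P.IsNatural P' φ)
    (hψ : P.IsNatural P' ψ) {x : X} (h : φ x = ψ x) : φ = ψ := by
  funext y
  ext v
  let γ : Path.Homotopic.Quotient x y := .mk (PathConnectedSpace.somePath x y)
  rw [← P.map_map_symm γ v, hφ, hψ, h]

theorem map_conj_eq_of_isIntertwiningMap {x : X} {f : V x →ₗ[R] V' x}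
    (hf : (P.holonomy x).IsIntertwiningMap (P'.holonomy x) f) {y : X}
    (γ γ' : Path.Homotopic.Quotient x y) (v : V y) :
    P'.map γ (f (P.map γ.symm v)) = P'.map γ' (f (P.map γ'.symm v)) := by
  have h := hf.isIntertwining (FundamentalGroup.fromPath (γ.trans γ'.symm)) (P.map γ.symm v)
  rw [holonomy_apply, holonomy_apply, P.map_trans, map_map_symm, P'.map_trans] at h
  rw [h, map_map_symm]

theorem exists_isNatural_of_isIntertwiningMap [PathConnectedSpace X] {x : X} {f : V x →ₗ[R] V' x}
    (hf : (P.holonomy x).IsIntertwiningMap (P'.holonomy x) f) :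
    ∃ φ : ∀ y, V y →ₗ[R] V' y, P.IsNatural P' φ ∧ φ x = f := by
  let p (y : X) : Path.Homotopic.Quotient x y := .mk (PathConnectedSpace.somePath x y)
  refine ⟨fun y => P'.map (p y) ∘ₗ f ∘ₗ P.map (p y).symm, fun y z γ v => ?_, ?_⟩
  · calc P'.map (p z) (f (P.map (p z).symm (P.map γ v)))
        = P'.map ((p y).trans γ) (f (P.map ((p y).trans γ).symm (P.map γ v))) :=
          map_conj_eq_of_isIntertwiningMap hf _ _ _
      _ = P'.map ((p y).trans γ) (f (P.map ((p y).trans γ).symm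
            (P.map ((p y).trans γ) (P.map (p y).symm v)))) := by
          rw [P.map_trans (p y), P.map_map_symm]
      _ = P'.map γ (P'.map (p y) (f (P.map (p y).symm v))) := by
          rw [P.map_symm_map, P'.map_trans]
  · ext v
    calc P'.map (p x) (f (P.map (p x).symm v))
        = P'.map (.refl x) (f (P.map (Path.Homotopic.Quotient.refl x).symm
            (P.map (.refl x) v))) := by
          rw [P.map_refl]
          exact map_conj_eq_of_isIntertwiningMap hf _ _ _
      _ = f v := by rw [P.map_symm_map, P'.map_refl]

/-- The representation of the fundamental groupoid induced by a representation of the fundamental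
group, by means of a choice `p` of paths from the base point. -/
noncomputable def ofRepresentation {x : X} {W : Type*} [AddCommMonoid W] [Module R W]
    (ρ : Representation R (FundamentalGroup X x) W) (p : ∀ y, Path.Homotopic.Quotient x y) :
    PathTransport R (fun _ : X => W) where
  map {y z} γ := ρ (FundamentalGroup.fromPath (((p y).trans γ).trans (p z).symm))
  map_refl y v := by
    rw [Path.Homotopic.Quotient.trans_refl, Path.Homotopic.Quotient.trans_symm]
    exact LinearMap.congr_fun ρ.map_one v
  map_trans {y z w} γ γ' v := by
    rw [← Module.End.mul_apply, ← map_mul, FundamentalGroup.mul_def]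
    congr 2
    change _ = (((p y).trans γ).trans (p z).symm).trans (((p z).trans γ').trans (p w).symm)
    simp only [Path.Homotopic.Quotient.trans_assoc]
    rw [← Path.Homotopic.Quotient.trans_assoc (p z).symm, Path.Homotopic.Quotient.symm_trans,
      Path.Homotopic.Quotient.refl_trans]

theorem isIntertwiningMap_ofRepresentation {x : X} {W : Type*} [AddCommMonoid W] [Module R W]
    (ρ : Representation R (FundamentalGroup X x) W) (p : ∀ y, Path.Homotopic.Quotient x y) :
    ((ofRepresentation ρ p).holonomy x).IsIntertwiningMap ρ
      (ρ (FundamentalGroup.fromPath (p x))) where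
  isIntertwining g v := by
    change ρ _ (ρ (FundamentalGroup.fromPath (((p x).trans g.toPath).trans (p x).symm)) v) = _
    rw [← Module.End.mul_apply, ← Module.End.mul_apply, ← map_mul, ← map_mul,
      FundamentalGroup.mul_def, FundamentalGroup.mul_def]
    congr 2
    change (((p x).trans g.toPath).trans (p x).symm).trans (p x) = (p x).trans g.toPath
    rw [Path.Homotopic.Quotient.trans_assoc, Path.Homotopic.Quotient.symm_trans,
      Path.Homotopic.Quotient.trans_refl]

end PathTransport

/-! ### Local systems -/

/-- A local system of modules `V y` with model `F`, given by a trivialization over an open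
neighbourhood of every point such that the transition maps are locally constant. -/
structure LocalSystem (R : Type*) [Semiring R] {X : Type*} [TopologicalSpace X]
    (F : Type*) [AddCommMonoid F] [Module R F]
    (V : X → Type*) [∀ y, AddCommMonoid (V y)] [∀ y, Module R (V y)] where
  /-- The domain of the trivialization around a point. -/
  baseSet : X → Set X
  isOpen_baseSet : ∀ c, IsOpen (baseSet c)
  mem_baseSet : ∀ c, c ∈ baseSet c
  /-- The trivialization around a point; only its values over the base set are relevant. -/
  triv : X → ∀ y, V y ≃ₗ[R] F
  eventually_transition_eq : ∀ c c' y, y ∈ baseSet c → y ∈ baseSet c' → ∀ᶠ z in 𝓝 y, ∀ u : F,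
    triv c' z ((triv c z).symm u) = triv c' y ((triv c y).symm u)

namespace LocalSystem

section CoveringSpace

variable {R : Type*} [Semiring R] {X : Type*} [TopologicalSpace X]
  {F : Type*} [AddCommMonoid F] [Module R F] [TopologicalSpace F] [DiscreteTopology F]
  {V : X → Type*} [∀ y, AddCommMonoid (V y)] [∀ y, Module R (V y)] (S : LocalSystem R F V)

/-- The covering space of a local system, as a fibre bundle with discrete fibre. -/
def core : FiberBundleCore X X F where
  baseSet := S.baseSet
  isOpen_baseSet := S.isOpen_baseSet
  indexAt := id
  mem_baseSet_at := S.mem_baseSet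
  coordChange i j y u := S.triv j y ((S.triv i y).symm u)
  coordChange_self i y _ v := LinearEquiv.apply_symm_apply _ _
  continuousOn_coordChange i j := by
    rintro ⟨y, u⟩ ⟨⟨hi, hj⟩, -⟩
    have hu : ∀ᶠ v : F in 𝓝 u, v = u := by
      rw [nhds_discrete]
      exact Filter.eventually_pure.2 rfl
    have hconst : ∀ᶠ p : X × F in 𝓝 (y, u),
        S.triv j y ((S.triv i y).symm u) = S.triv j p.1 ((S.triv i p.1).symm p.2) := by
      rw [nhds_prod_eq]
      filter_upwards [(S.eventually_transition_eq i j y hi hj).prod_mk hu] with p hp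
      rw [hp.2, hp.1 u]
    exact (continuousAt_const.congr hconst).continuousWithinAt
  coordChange_comp i j k y _ v := by rw [LinearEquiv.symm_apply_apply]

theorem isCoveringMap : IsCoveringMap (π F S.core.Fiber) :=
  FiberBundle.isCoveringMap

/-- The points of the covering space over `y` are the elements of `V y`. -/
def fiberEquiv (y : X) : V y ≃ π F S.core.Fiber ⁻¹' {y} where
  toFun v := ⟨⟨y, S.triv y y v⟩, rfl⟩
  invFun e := (S.triv y y).symm e.1.2
  left_inv v := LinearEquiv.symm_apply_apply _ _
  right_inv := by
    rintro ⟨⟨z, u⟩, hz⟩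
    obtain rfl : z = y := hz
    exact Subtype.ext (congrArg (fun w : F => (⟨z, w⟩ : S.core.TotalSpace))
      ((S.triv z z).apply_symm_apply u))

/-- The monodromy action of the homotopy classes of paths on the covering space, read on `V`. -/
noncomputable def monodromy {y z : X} (γ : Path.Homotopic.Quotient y z) (v : V y) : V z :=
  (S.fiberEquiv z).symm (S.isCoveringMap.monodromy γ (S.fiberEquiv y v))

theorem monodromy_refl (y : X) (v : V y) : S.monodromy (.refl y) v = v := by
  rw [monodromy, IsCoveringMap.monodromy_refl, id, Equiv.symm_apply_apply]

theorem monodromy_trans {y z w : X} (γ : Path.Homotopic.Quotient y z)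
    (γ' : Path.Homotopic.Quotient z w) (v : V y) :
    S.monodromy (γ.trans γ') v = S.monodromy γ' (S.monodromy γ v) := by
  rw [monodromy, IsCoveringMap.monodromy_trans_apply, monodromy, monodromy, Equiv.apply_symm_apply]

theorem monodromy_mk_of_range_subset {c y z : X} (γ : Path y z) (h : range γ ⊆ S.baseSet c)
    (v : V y) : S.monodromy (.mk γ) v = (S.triv c z).symm (S.triv c y v) := by
  let lift : unitInterval → S.core.TotalSpace := fun t =>
    (S.core.localTriv c).toOpenPartialHomeomorph.symm (γ t, S.triv c y v)
  have lift_eq : ∀ t, lift t = (S.fiberEquiv (γ t) ((S.triv c (γ t)).symm (S.triv c y v))).1 :=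
    fun t => rfl
  have lift_continuous : Continuous lift := by
    refine (S.core.localTriv c).toOpenPartialHomeomorph.continuousOn_symm.comp_continuous
      (γ.continuous.prodMk continuous_const) fun t => ?_
    exact (S.core.localTriv c).mem_target.2 (h ⟨t, rfl⟩)
  have lift_zero : lift 0 = (S.fiberEquiv y v).1 := by
    rw [lift_eq, γ.source, LinearEquiv.symm_apply_apply]
  have lift_one : lift 1 = (S.fiberEquiv z ((S.triv c z).symm (S.triv c y v))).1 := by
    rw [lift_eq, γ.target]
  have hlift := (S.isCoveringMap.eq_liftPath_iff (γ := γ) (Γ := lift) γ.source).2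
    ⟨lift_continuous, rfl, lift_zero⟩
  have hend : (S.isCoveringMap.monodromy (.mk γ) (S.fiberEquiv y v)).1 = lift 1 := by
    rw [hlift]
    rfl
  rw [monodromy, Equiv.symm_apply_eq]
  exact Subtype.ext (hend.trans lift_one)

theorem isLinearMap_monodromy {y z : X} (γ : Path.Homotopic.Quotient y z) :
    IsLinearMap R (S.monodromy γ) := by
  refine pathHomotopicQuotient_induction_of_cover S.isOpen_baseSet S.mem_baseSet
    (P := fun γ => IsLinearMap R (S.monodromy γ)) ?_ ?_ γ
  · intro a b c p q hp hq
    constructor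
    · intro v w
      simp only [monodromy_trans, hp.map_add, hq.map_add]
    · intro r v
      simp only [monodromy_trans, hp.map_smul, hq.map_smul]
  · intro c y z γ hγ
    constructor <;> intros <;> simp only [S.monodromy_mk_of_range_subset γ hγ, map_add, map_smul]

end CoveringSpace

variable {R : Type*} [CommSemiring R] {X : Type*} [TopologicalSpace X]
  {F : Type*} [AddCommMonoid F] [Module R F]
  {V : X → Type*} [∀ y, AddCommMonoid (V y)] [∀ y, Module R (V y)] (S : LocalSystem R F V)
  {F' : Type*} [AddCommMonoid F'] [Module R F']
  {V' : X → Type*} [∀ y, AddCommMonoid (V' y)] [∀ y, Module R (V' y)] (S' : LocalSystem R F' V')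

/-- Transport in a local system along homotopy classes of paths: the monodromy of its covering
space, for the discrete topology on the model. -/
noncomputable def transport : PathTransport R V :=
  letI : TopologicalSpace F := ⊥
  haveI : DiscreteTopology F := ⟨rfl⟩
  { map := fun γ => (S.isLinearMap_monodromy γ).mk' _
    map_refl := S.monodromy_refl
    map_trans := S.monodromy_trans }

theorem transport_mk_of_range_subset {c y z : X} (γ : Path y z) (h : range γ ⊆ S.baseSet c)
    (v : V y) : S.transport.map (.mk γ) v = (S.triv c z).symm (S.triv c y v) :=
  letI : TopologicalSpace F := ⊥
  haveI : DiscreteTopology F := ⟨rfl⟩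
  S.monodromy_mk_of_range_subset γ h v

theorem transport_eq {P : PathTransport R V}
    (hP : ∀ c {y z : X} (γ : Path y z), range γ ⊆ S.baseSet c → ∀ v,
      S.triv c z (P.map (.mk γ) v) = S.triv c y v)
    {y z : X} (γ : Path.Homotopic.Quotient y z) (v : V y) :
    S.transport.map γ v = P.map γ v := by
  revert v
  refine pathHomotopicQuotient_induction_of_cover S.isOpen_baseSet S.mem_baseSet
    (P := fun {y z} γ => ∀ v, S.transport.map γ v = P.map γ v) ?_ ?_ γ
  · intro y z w p q hp hq v
    rw [PathTransport.map_trans, hp, hq, P.map_trans]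
  · intro c y z γ hγ v
    rw [S.transport_mk_of_range_subset γ hγ, LinearEquiv.symm_apply_eq, hP c γ hγ]

/-- A family of linear maps between the modules of two local systems is a morphism of local
systems if it is locally constant in the trivializations. -/
def IsMorphism (φ : ∀ y, V y →ₗ[R] V' y) : Prop :=
  ∀ c c' y, y ∈ S.baseSet c → y ∈ S'.baseSet c' → ∀ᶠ z in 𝓝 y, ∀ u : F,
    S'.triv c' z (φ z ((S.triv c z).symm u)) = S'.triv c' y (φ y ((S.triv c y).symm u))

variable {S S'}

theorem IsMorphism.isNatural {φ : ∀ y, V y →ₗ[R] V' y} (hφ : S.IsMorphism S' φ) :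
    S.transport.IsNatural S'.transport φ := by
  intro y z γ
  refine pathHomotopicQuotient_induction_of_cover (U := fun c => S.baseSet c ∩ S'.baseSet c)
    (fun c => (S.isOpen_baseSet c).inter (S'.isOpen_baseSet c))
    (fun c => ⟨S.mem_baseSet c, S'.mem_baseSet c⟩)
    (P := fun {y z} γ => ∀ v : V y, φ z (S.transport.map γ v) = S'.transport.map γ (φ y v))
    ?_ ?_ γ
  · intro a b c p q hp hq v
    rw [PathTransport.map_trans, hq, hp, PathTransport.map_trans]
  · intro c y z γ hγ v
    rw [S.transport_mk_of_range_subset γ (hγ.trans inter_subset_left),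
      S'.transport_mk_of_range_subset γ (hγ.trans inter_subset_right)]
    have hconst := path_apply_eq_of_eventually_eq γ
      (f := fun w => fun u : F => S'.triv c w (φ w ((S.triv c w).symm u))) fun w hw =>
        (hφ c c w (hγ hw).1 (hγ hw).2).mono fun w' hw' => funext hw'
    have hv := congrFun hconst (S.triv c y v)
    simp only [LinearEquiv.symm_apply_apply] at hv
    rw [hv, LinearEquiv.symm_apply_apply]

theorem isMorphism_of_isNatural [LocallyPathConnectedSpace X] {φ : ∀ y, V y →ₗ[R] V' y}
    (hφ : S.transport.IsNatural S'.transport φ) : S.IsMorphism S' φ := by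
  intro c c' y hc hc'
  have hnhds := ((S.isOpen_baseSet c).inter (S'.isOpen_baseSet c')).mem_nhds ⟨hc, hc'⟩
  filter_upwards [eventually_exists_path_range_subset hnhds] with z ⟨γ, hγ⟩ u
  have h := hφ (.mk γ) ((S.triv c y).symm u)
  rw [S.transport_mk_of_range_subset γ (hγ.trans inter_subset_left),
    S'.transport_mk_of_range_subset γ (hγ.trans inter_subset_right),
    LinearEquiv.apply_symm_apply] at h
  rw [h, LinearEquiv.apply_symm_apply]

end LocalSystem

theorem path_homotopic_of_range_subset {X : Type*} [TopologicalSpace X] {U : Set X}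
    (hU : IsSimplyConnected U) {y z : X} {γ γ' : Path y z} (h : range γ ⊆ U) (h' : range γ' ⊆ U) :
    γ.Homotopic γ' := by
  have := hU.simplyConnectedSpace
  have hy : y ∈ U := h ⟨0, γ.source⟩
  have hz : z ∈ U := h ⟨1, γ.target⟩
  let restrict (δ : Path y z) (hδ : range δ ⊆ U) : Path (⟨y, hy⟩ : U) ⟨z, hz⟩ :=
    { toFun := fun t => ⟨δ t, hδ ⟨t, rfl⟩⟩
      source' := Subtype.ext δ.source
      target' := Subtype.ext δ.target }
  exact (SimplyConnectedSpace.paths_homotopic (restrict γ h) (restrict γ' h')).map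
    (⟨Subtype.val, continuous_subtype_val⟩ : C(U, X))

namespace PathTransport

variable {R : Type*} [CommSemiring R] {X : Type*} [TopologicalSpace X]
  {V : X → Type*} [∀ y, AddCommMonoid (V y)] [∀ y, Module R (V y)] (P : PathTransport R V)
  {F : Type*} [AddCommMonoid F] [Module R F] (L : ∀ y, V y ≃ₗ[R] F)
  {U : X → Set X} (hmem : ∀ c, c ∈ U c) (hsc : ∀ c, IsSimplyConnected (U c))

open Classical in
/-- The trivialization over the simply connected set `U c` obtained by transport to `c`; the value
`L y` at a point `y` outside `U c` is irrelevant. -/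
noncomputable def triv (c y : X) : V y ≃ₗ[R] F :=
  if h : y ∈ U c then
    (P.equiv (.mk ((hsc c).isPathConnected.joinedIn y h c (hmem c)).somePath)).trans (L c)
  else L y

theorem triv_map {c y z : X} (γ : Path y z) (hγ : range γ ⊆ U c) (v : V y) :
    P.triv L hmem hsc c z (P.map (.mk γ) v) = P.triv L hmem hsc c y v := by
  have hy : y ∈ U c := hγ ⟨0, γ.source⟩
  have hz : z ∈ U c := hγ ⟨1, γ.target⟩
  have hy_path := (hsc c).isPathConnected.joinedIn y hy c (hmem c)
  have hz_path := (hsc c).isPathConnected.joinedIn z hz c (hmem c)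
  have homotopic : (γ.trans hz_path.somePath).Homotopic hy_path.somePath := by
    refine path_homotopic_of_range_subset (hsc c) ?_ (range_subset_iff.2 hy_path.somePath_mem)
    rw [Path.trans_range]
    exact union_subset hγ (range_subset_iff.2 hz_path.somePath_mem)
  simp only [triv, hy, hz, dif_pos, LinearEquiv.trans_apply, equiv_apply]
  rw [← P.map_trans, ← Path.Homotopic.Quotient.mk_trans,
    Path.Homotopic.Quotient.eq.2 homotopic]

/-- The local system of a representation of the fundamental groupoid. -/
noncomputable def localSystem [LocallyPathConnectedSpace X] (hU : ∀ c, IsOpen (U c)) :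
    LocalSystem R F V where
  baseSet := U
  isOpen_baseSet := hU
  mem_baseSet := hmem
  triv := P.triv L hmem hsc
  eventually_transition_eq c c' y hc hc' := by
    have hnhds := ((hU c).inter (hU c')).mem_nhds ⟨hc, hc'⟩
    filter_upwards [eventually_exists_path_range_subset hnhds] with z ⟨γ, hγ⟩ u
    have h := P.triv_map L hmem hsc γ (hγ.trans inter_subset_left)
      ((P.triv L hmem hsc c y).symm u)
    rw [LinearEquiv.apply_symm_apply, ← LinearEquiv.eq_symm_apply] at h
    rw [← h, P.triv_map L hmem hsc γ (hγ.trans inter_subset_right)]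

theorem transport_localSystem [LocallyPathConnectedSpace X] (hU : ∀ c, IsOpen (U c)) {y z : X}
    (γ : Path.Homotopic.Quotient y z) (v : V y) :
    (P.localSystem L hmem hsc hU).transport.map γ v = P.map γ v :=
  (P.localSystem L hmem hsc hU).transport_eq (fun _ _ _ => P.triv_map L hmem hsc) γ v

end PathTransport

/-! ### Flat connection forms on normed spaces -/

section Gauge

open Metric

variable {E 𝔸 : Type*} [NormedAddCommGroup E] [NormedSpace ℝ E]
  [NormedRing 𝔸] [NormedAlgebra ℝ 𝔸]

/-- The Maurer–Cartan equation `dA + A ∧ A = 0` on the set `s` for a connection form `A` with values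
in a normed algebra. -/
def IsFlatForm (A : E → E →L[ℝ] 𝔸) (s : Set E) : Prop :=
  ∀ p ∈ s, ∀ v w, fderiv ℝ A p v w - fderiv ℝ A p w v + A p v * A p w - A p w * A p v = 0

/-- The function `G` solves the total differential equation `dG = -A G` on the set `s`: it is a
gauge transformation which trivializes the connection form `A`. -/
def IsGauge (A : E → E →L[ℝ] 𝔸) (G : E → 𝔸) (s : Set E) : Prop :=
  ∀ p ∈ s, HasFDerivAt G (-((ContinuousLinearMap.mul ℝ 𝔸).flip (G p) ∘L A p)) p

theorem IsGauge.fderiv_apply {A : E → E →L[ℝ] 𝔸} {G : E → 𝔸} {s : Set E} (hG : IsGauge A G s)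
    {p : E} (hp : p ∈ s) (v : E) : fderiv ℝ G p v = -(A p v * G p) := by
  rw [(hG p hp).fderiv]
  rfl

theorem IsGauge.contDiffOn {A : E → E →L[ℝ] 𝔸} {G : E → 𝔸} {s : Set E} (hG : IsGauge A G s)
    (hs : IsOpen s) (hA : ContDiffOn ℝ ∞ A s) : ContDiffOn ℝ ∞ G s := by
  rw [contDiffOn_infty]
  intro n
  induction n with
  | zero => exact contDiffOn_zero.2 fun p hp => (hG p hp).continuousAt.continuousWithinAt
  | succ n ih =>
    have hdG : ContDiffOn ℝ n (fun p => -((ContinuousLinearMap.mul ℝ 𝔸).flip (G p) ∘L A p)) s :=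
      (((ContinuousLinearMap.contDiff _).comp_contDiffOn ih).clm_comp
        (hA.of_le (by exact_mod_cast le_top))).neg
    push_cast
    rw [contDiffOn_succ_iff_fderiv_of_isOpen hs]
    exact ⟨fun p hp => (hG p hp).differentiableAt.differentiableWithinAt, by simp,
      hdG.congr fun p hp => (hG p hp).fderiv⟩

theorem exists_hasDerivWithinAt_neg_mul [CompleteSpace 𝔸] {α : ℝ → 𝔸}
    (hα : ContinuousOn α (Icc 0 1)) (hα_le : ∀ t ∈ Icc (0 : ℝ) 1, ‖α t‖ ≤ 1 / 2) :
    ∃ g : ℝ → 𝔸, g 0 = 1 ∧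
      ∀ t ∈ Icc (0 : ℝ) 1, HasDerivWithinAt g (-(α t * g t)) (Icc 0 1) t := by
  have hP : IsPicardLindelof (fun t x => -(α t * x)) (⟨0, by simp⟩ : Icc (0 : ℝ) 1) (1 : 𝔸)
      ‖(1 : 𝔸)‖₊ 0 ‖(1 : 𝔸)‖₊ 1 := by
    refine ⟨fun t ht => ?_, fun x _ => (hα.mul continuousOn_const).neg, fun t ht x hx => ?_, ?_⟩
    · refine LipschitzOnWith.of_dist_le_mul fun x _ y _ => ?_
      rw [dist_neg_neg, dist_eq_norm, dist_eq_norm, ← mul_sub]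
      refine (norm_mul_le _ _).trans (mul_le_mul_of_nonneg_right ?_ (norm_nonneg _))
      exact (hα_le t ht).trans (by norm_num)
    · have hx_le : ‖x‖ ≤ ‖(1 : 𝔸)‖ + ‖(1 : 𝔸)‖ := by
        have := norm_le_norm_add_norm_sub' x 1
        have : ‖x - 1‖ ≤ ‖(1 : 𝔸)‖ := mem_closedBall_iff_norm.1 hx
        linarith
      calc ‖-(α t * x)‖ ≤ ‖α t‖ * ‖x‖ := by
            rw [norm_neg]
            exact norm_mul_le _ _
        _ ≤ 1 / 2 * (‖(1 : 𝔸)‖ + ‖(1 : 𝔸)‖) := by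
            gcongr
            exact hα_le t ht
        _ = ‖(1 : 𝔸)‖₊ := by
            rw [coe_nnnorm]
            ring
    · simp
  exact hP.exists_eq_forall_mem_Icc_hasDerivWithinAt₀

theorem norm_le_gronwallBound_of_hasDerivWithinAt_neg_mul_add {α ρ f : ℝ → 𝔸} {δ ε : ℝ}
    (hf : ∀ t ∈ Icc (0 : ℝ) 1, HasDerivWithinAt f (-(α t * f t) + ρ t) (Icc 0 1) t)
    (hα : ∀ t ∈ Icc (0 : ℝ) 1, ‖α t‖ ≤ 1) (hρ : ∀ t ∈ Icc (0 : ℝ) 1, ‖ρ t‖ ≤ ε)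
    (h0 : ‖f 0‖ ≤ δ) {t : ℝ} (ht : t ∈ Icc (0 : ℝ) 1) : ‖f t‖ ≤ gronwallBound δ 1 ε t := by
  simpa only [sub_zero] using norm_le_gronwallBound_of_norm_deriv_right_le
    (fun s hs => (hf s hs).continuousWithinAt)
    (fun s hs => (hf s (Ico_subset_Icc_self hs)).mono_of_mem_nhdsWithin
      (Icc_mem_nhdsGE_of_mem hs)) h0
    (fun s hs => by
      have hs' := Ico_subset_Icc_self hs
      refine (norm_add_le _ _).trans (add_le_add ?_ (hρ s hs'))
      rw [norm_neg]
      exact (norm_mul_le _ _).trans (mul_le_mul_of_nonneg_right (hα s hs') (norm_nonneg _))) t ht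

theorem norm_sub_sub_fderiv_le_of_lipschitzOnWith {H : Type*} [NormedAddCommGroup H]
    [NormedSpace ℝ H] {f : E → H} {s : Set E} (hs : Convex ℝ s)
    (hf : ∀ q ∈ s, DifferentiableAt ℝ f q) {L : NNReal} (hL : LipschitzOnWith L (fderiv ℝ f) s)
    {x y : E} (hx : x ∈ s) (hy : y ∈ s) :
    ‖f y - f x - fderiv ℝ f x (y - x)‖ ≤ L * ‖y - x‖ ^ 2 := by
  have hsub : segment ℝ x y ⊆ s := hs.segment_subset hx hy
  have h := (convex_segment x y).norm_image_sub_le_of_norm_fderiv_le' (𝕜 := ℝ) (f := f)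
    (φ := fderiv ℝ f x) (C := L * ‖y - x‖) (fun q hq => hf q (hsub hq))
    (fun q hq => (hL.norm_sub_le (hsub hq) hx).trans
      (mul_le_mul_of_nonneg_left (norm_sub_le_of_mem_segment hq) L.2))
    (left_mem_segment ℝ x y) (right_mem_segment ℝ x y)
  rwa [mul_assoc, ← sq] at h

theorem hasFDerivAt_of_norm_sub_sub_le_sq {H : Type*} [NormedAddCommGroup H] [NormedSpace ℝ H]
    {f : E → H} {f' : E →L[ℝ] H} {p : E} {C : ℝ}
    (h : ∀ᶠ v in 𝓝 0, ‖f (p + v) - f p - f' v‖ ≤ C * ‖v‖ ^ 2) : HasFDerivAt f f' p := by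
  rw [hasFDerivAt_iff_isLittleO_nhds_zero]
  refine Asymptotics.IsBigO.trans_isLittleO (g := fun v : E => ‖v‖ ^ 2)
    (Asymptotics.IsBigO.of_bound C ?_) (Asymptotics.isLittleO_norm_pow_id one_lt_two)
  simpa only [norm_pow, norm_norm] using h

/-- The function `g` solves the equation of parallel transport for the connection form `A` along the
segment from `0` to `p`. -/
structure IsRadialSolution (A : E → E →L[ℝ] 𝔸) (p : E) (g : ℝ → 𝔸) : Prop where
  map_zero : g 0 = 1
  hasDerivWithinAt : ∀ t ∈ Icc (0 : ℝ) 1,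
    HasDerivWithinAt g (-(A (t • p) p * g t)) (Icc 0 1) t

/-- The quantitative hypotheses under which the radial solutions of `A` are estimated on the ball of
radius `r` around `0`: `r` is small compared to the bound `M` of `A` and of its derivative. -/
structure HasGaugeBounds (A : E → E →L[ℝ] 𝔸) (r : ℝ) (M L : NNReal) : Prop where
  radius_pos : 0 < r
  radius_le_one : r ≤ 1
  bound_mul_radius_le : M * r ≤ 1 / 2
  differentiableAt : ∀ p ∈ ball (0 : E) r, DifferentiableAt ℝ A p
  norm_le : ∀ p ∈ ball (0 : E) r, ‖A p‖ ≤ M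
  lipschitzOnWith : LipschitzOnWith M A (ball 0 r)
  lipschitzOnWith_fderiv : LipschitzOnWith L (fderiv ℝ A) (ball 0 r)

theorem smul_mem_ball_zero {r : ℝ} {p : E} (hp : p ∈ ball (0 : E) r) {t : ℝ}
    (ht : t ∈ Icc (0 : ℝ) 1) : t • p ∈ ball (0 : E) r :=
  (convex_ball (0 : E) r).smul_mem_of_zero_mem
    (mem_ball_self (pos_of_mem_ball hp)) hp ht

namespace HasGaugeBounds

variable {A : E → E →L[ℝ] 𝔸} {r : ℝ} {M L : NNReal}

theorem norm_apply_le (hA : HasGaugeBounds A r M L) {p : E} (hp : p ∈ ball (0 : E) r) {t : ℝ}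
    (ht : t ∈ Icc (0 : ℝ) 1) : ‖A (t • p) p‖ ≤ 1 / 2 :=
  ((A (t • p)).le_of_opNorm_le_of_le (hA.norm_le _ (smul_mem_ball_zero hp ht))
    (mem_ball_zero_iff.1 hp).le).trans hA.bound_mul_radius_le

theorem hasDerivAt_apply (hA : HasGaugeBounds A r M L) {p : E} (hp : p ∈ ball (0 : E) r) {t : ℝ}
    (ht : t ∈ Icc (0 : ℝ) 1) (v : E) :
    HasDerivAt (fun t : ℝ => A (t • p) v) (fderiv ℝ A (t • p) p v) t := by
  have hray : HasDerivAt (fun t : ℝ => t • p) p t := by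
    simpa only [id, one_smul] using (hasDerivAt_id t).smul_const p
  have hA_ray := (hA.differentiableAt _ (smul_mem_ball_zero hp ht)).hasFDerivAt.comp_hasDerivAt t
    hray
  simpa using hA_ray.clm_apply (hasDerivAt_const t v)

theorem exists_isRadialSolution [CompleteSpace 𝔸] (hA : HasGaugeBounds A r M L) {p : E}
    (hp : p ∈ ball (0 : E) r) : ∃ g, IsRadialSolution A p g := by
  obtain ⟨g, hg0, hg⟩ := exists_hasDerivWithinAt_neg_mul
    (fun t ht => (hA.hasDerivAt_apply hp ht p).continuousAt.continuousWithinAt)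
    fun t ht => hA.norm_apply_le hp ht
  exact ⟨g, hg0, hg⟩

theorem norm_radialSolution_le (hA : HasGaugeBounds A r M L) {p : E} (hp : p ∈ ball (0 : E) r)
    {g : ℝ → 𝔸} (hg : IsRadialSolution A p g) {t : ℝ} (ht : t ∈ Icc (0 : ℝ) 1) :
    ‖g t‖ ≤ ‖(1 : 𝔸)‖ * Real.exp 1 := by
  have h := norm_le_gronwallBound_of_hasDerivWithinAt_neg_mul_add (ρ := 0) (ε := 0)
    (fun s hs => (hg.hasDerivWithinAt s hs).congr_deriv (add_zero _).symm)
    (fun s hs => (hA.norm_apply_le hp hs).trans (by norm_num)) (fun s _ => norm_zero.le)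
    (congrArg norm hg.map_zero).le ht
  rw [gronwallBound_ε0, one_mul] at h
  exact h.trans (by gcongr; exact ht.2)

end HasGaugeBounds

/-- The defect with which `(1 - t A(tp) h) g(t)`, for a radial solution `g` towards `p`, solves the
radial equation towards `p + h`. -/
noncomputable def gaugeDefect (A : E → E →L[ℝ] 𝔸) (p h : E) (t : ℝ) : 𝔸 :=
  A (t • (p + h)) (p + h) * (1 - t • A (t • p) h) -
    (A (t • p) h + t • fderiv ℝ A (t • p) p h) - (1 - t • A (t • p) h) * A (t • p) p

-- Flatness trades `D p h` for `D h p` up to products, after which all first order terms cancel.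
theorem gaugeDefect_eq {A : E → E →L[ℝ] 𝔸} {s : Set E} (hflat : IsFlatForm A s) {p : E} {t : ℝ}
    (hp : t • p ∈ s) (h : E) :
    gaugeDefect A p h t =
      (A (t • (p + h)) - A (t • p) - fderiv ℝ A (t • p) (t • h)) p +
        (A (t • (p + h)) - A (t • p)) h -
        t • ((A (t • p) h + (A (t • (p + h)) - A (t • p)) p + (A (t • (p + h)) - A (t • p)) h) *
          A (t • p) h) := by
  rw [gaugeDefect]
  set a := A (t • p)
  set D := fderiv ℝ A (t • p)
  have hD : D p h = D h p - a p * a h + a h * a p := by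
    rw [← sub_eq_zero, ← hflat _ hp p h]
    abel
  rw [hD]
  simp only [map_add, map_smul, sub_apply, smul_apply, mul_sub, sub_mul, add_mul, mul_one, one_mul,
    mul_smul_comm, smul_mul_assoc, smul_add, smul_sub]
  abel

theorem HasGaugeBounds.norm_gaugeDefect_le {A : E → E →L[ℝ] 𝔸} {r : ℝ} {M L : NNReal}
    (hA : HasGaugeBounds A r M L) (hflat : IsFlatForm A (ball 0 r)) {p h : E}
    (hp : p ∈ ball (0 : E) r) (hph : p + h ∈ ball (0 : E) r) (hh : ‖h‖ ≤ 1) {t : ℝ}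
    (ht : t ∈ Icc (0 : ℝ) 1) : ‖gaugeDefect A p h t‖ ≤ (L + M + 3 * M ^ 2) * ‖h‖ ^ 2 := by
  have hx := smul_mem_ball_zero hp ht
  have hy := smul_mem_ball_zero hph ht
  have hp_le : ‖p‖ ≤ 1 := (mem_ball_zero_iff.1 hp).le.trans hA.radius_le_one
  have hyx : t • (p + h) - t • p = t • h := by
    rw [smul_add, add_sub_cancel_left]
  have hth : ‖t • h‖ ≤ ‖h‖ := by
    rw [norm_smul, Real.norm_of_nonneg ht.1]
    exact mul_le_of_le_one_left (norm_nonneg _) ht.2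
  have hδ : ‖A (t • (p + h)) - A (t • p)‖ ≤ M * ‖h‖ := by
    have := hA.lipschitzOnWith.norm_sub_le hy hx
    rw [hyx] at this
    exact this.trans (by gcongr)
  have hρ : ‖A (t • (p + h)) - A (t • p) - fderiv ℝ A (t • p) (t • h)‖ ≤ L * ‖h‖ ^ 2 := by
    have := norm_sub_sub_fderiv_le_of_lipschitzOnWith (convex_ball (0 : E) r)
      hA.differentiableAt hA.lipschitzOnWith_fderiv hx hy
    rw [hyx] at this
    exact this.trans (by gcongr)
  rw [gaugeDefect_eq hflat hx]
  set a := A (t • p)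
  set δ := A (t • (p + h)) - a
  have hρp := ContinuousLinearMap.le_of_opNorm_le_of_le _ hρ hp_le
  have hδp := δ.le_of_opNorm_le_of_le hδ hp_le
  have hδh := δ.le_of_opNorm_le_of_le hδ le_rfl (x := h)
  have hδh' := δ.le_of_opNorm_le_of_le hδ hh
  have hah := a.le_of_opNorm_le_of_le (hA.norm_le _ hx) le_rfl (x := h)
  have hprod : ‖t • ((a h + δ p + δ h) * a h)‖ ≤ 3 * (M * ‖h‖) * (M * ‖h‖) := by
    have hsum : ‖a h + δ p + δ h‖ ≤ 3 * (M * ‖h‖) := norm_add₃_le.trans (by linarith)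
    calc ‖t • ((a h + δ p + δ h) * a h)‖ ≤ 1 * (‖a h + δ p + δ h‖ * ‖a h‖) := by
          rw [norm_smul, Real.norm_of_nonneg ht.1]
          gcongr
          exacts [ht.2, norm_mul_le _ _]
      _ ≤ 3 * (M * ‖h‖) * (M * ‖h‖) := by
          rw [one_mul]
          gcongr
  refine (norm_sub_le _ _).trans ((add_le_add (norm_add_le _ _) le_rfl).trans ?_)
  linarith

theorem HasGaugeBounds.hasDerivWithinAt_radialSolution_sub {A : E → E →L[ℝ] 𝔸} {r : ℝ}
    {M L : NNReal} (hA : HasGaugeBounds A r M L) {p h : E} (hp : p ∈ ball (0 : E) r)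
    {g g' : ℝ → 𝔸} (hg : IsRadialSolution A p g) (hg' : IsRadialSolution A (p + h) g') {t : ℝ}
    (ht : t ∈ Icc (0 : ℝ) 1) :
    HasDerivWithinAt (fun t => g' t - (1 - t • A (t • p) h) * g t)
      (-(A (t • (p + h)) (p + h) * (g' t - (1 - t • A (t • p) h) * g t)) +
        -(gaugeDefect A p h t * g t)) (Icc 0 1) t := by
  have hfactor : HasDerivAt (fun t : ℝ => (1 : 𝔸) - t • A (t • p) h)
      (-(t • fderiv ℝ A (t • p) p h + A (t • p) h)) t := by
    simpa using ((hasDerivAt_id t).smul (hA.hasDerivAt_apply hp ht h)).const_sub (1 : 𝔸)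
  refine ((hg'.hasDerivWithinAt t ht).sub
    (hfactor.hasDerivWithinAt.mul (hg.hasDerivWithinAt t ht))).congr_deriv ?_
  simp only [gaugeDefect, mul_sub, sub_mul, add_mul, neg_mul, mul_neg, mul_one, one_mul, mul_assoc]
  abel

theorem HasGaugeBounds.norm_radialSolution_sub_le {A : E → E →L[ℝ] 𝔸} {r : ℝ} {M L : NNReal}
    (hA : HasGaugeBounds A r M L) (hflat : IsFlatForm A (ball 0 r)) {p h : E}
    (hp : p ∈ ball (0 : E) r) (hph : p + h ∈ ball (0 : E) r) (hh : ‖h‖ ≤ 1)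
    {g g' : ℝ → 𝔸} (hg : IsRadialSolution A p g) (hg' : IsRadialSolution A (p + h) g') :
    ‖g' 1 - (1 - A p h) * g 1‖ ≤
      (L + M + 3 * M ^ 2) * (‖(1 : 𝔸)‖ * Real.exp 1) * (Real.exp 1 - 1) * ‖h‖ ^ 2 := by
  have hgrowth := norm_le_gronwallBound_of_hasDerivWithinAt_neg_mul_add
    (fun t ht => hA.hasDerivWithinAt_radialSolution_sub hp hg hg' ht)
    (fun t ht => (hA.norm_apply_le hph ht).trans (by norm_num))
    (ε := (L + M + 3 * M ^ 2) * ‖h‖ ^ 2 * (‖(1 : 𝔸)‖ * Real.exp 1)) (δ := 0)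
    (fun t ht => by
      rw [norm_neg]
      refine (norm_mul_le _ _).trans ?_
      gcongr
      exacts [hA.norm_gaugeDefect_le hflat hp hph hh ht, hA.norm_radialSolution_le hp hg ht])
    (by simp [hg.map_zero, hg'.map_zero]) (right_mem_Icc.2 zero_le_one)
  rw [gronwallBound_of_K_ne_0 one_ne_zero] at hgrowth
  simp only [one_smul, div_one, zero_mul, zero_add, mul_one] at hgrowth
  exact hgrowth.trans_eq (by ring)

theorem HasGaugeBounds.exists_isGauge [CompleteSpace 𝔸] {A : E → E →L[ℝ] 𝔸} {r : ℝ} {M L : NNReal}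
    (hA : HasGaugeBounds A r M L) (hflat : IsFlatForm A (ball 0 r)) :
    ∃ G : E → 𝔸, G 0 = 1 ∧ IsGauge A G (ball 0 r) := by
  choose! g hg using fun p (hp : p ∈ ball (0 : E) r) => hA.exists_isRadialSolution hp
  refine ⟨fun p => g p 1, ?_, fun p hp => ?_⟩
  · have hg_zero := hg 0 (mem_ball_self hA.radius_pos)
    refine (constant_of_has_deriv_right_zero
      (fun t ht => (hg_zero.hasDerivWithinAt t ht).continuousWithinAt) (fun t ht => ?_) 1
      (right_mem_Icc.2 zero_le_one)).trans hg_zero.map_zero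
    simpa using (hg_zero.hasDerivWithinAt t (Ico_subset_Icc_self ht)).mono_of_mem_nhdsWithin
      (Icc_mem_nhdsGE_of_mem ht)
  · have hadd : ContinuousAt (fun h : E => p + h) 0 := by fun_prop
    refine hasFDerivAt_of_norm_sub_sub_le_sq
      (C := (L + M + 3 * M ^ 2) * (‖(1 : 𝔸)‖ * Real.exp 1) * (Real.exp 1 - 1)) ?_
    filter_upwards [closedBall_mem_nhds (0 : E) one_pos,
      hadd.eventually ((isOpen_ball (x := (0 : E)) (ε := r)).mem_nhds (by simpa using hp))]
      with h hh hph
    refine (congrArg norm ?_).trans_le (hA.norm_radialSolution_sub_le hflat hp hph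
      (mem_closedBall_zero_iff.1 hh) (hg p hp) (hg _ hph))
    simp only [neg_apply, ContinuousLinearMap.comp_apply, ContinuousLinearMap.flip_apply,
      ContinuousLinearMap.mul_apply', sub_mul, one_mul]
    abel

theorem exists_hasGaugeBounds {A : E → E →L[ℝ] 𝔸} {O : Set E} (hO : O ∈ 𝓝 0)
    (hA : ContDiffOn ℝ 2 A O) :
    ∃ r M L, HasGaugeBounds A r M L ∧ ball 0 r ⊆ O := by
  have hA0 : ContDiffAt ℝ 2 A 0 := hA.contDiffAt hO
  obtain ⟨K, s, hs, hK⟩ := (hA0.of_le one_le_two).exists_lipschitzOnWith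
  obtain ⟨L, s', hs', hL⟩ := (hA0.fderiv_right (m := 1) (by norm_num)).exists_lipschitzOnWith
  obtain ⟨ε, hε, hball⟩ := Metric.eventually_nhds_iff_ball.1 <|
    (eventually_mem_nhds_iff.2 hO).and (Filter.inter_mem hs hs')
  set M := K + ‖A 0‖₊
  obtain ⟨r, hr, hr_lt⟩ := exists_between
    (show (0 : ℝ) < min ε (min 1 (1 / (2 * (M + 1)))) by positivity)
  simp only [lt_min_iff, lt_div_iff₀ (show 0 < 2 * ((M : ℝ) + 1) by positivity)] at hr_lt
  obtain ⟨hrε, hr_one, hrM⟩ := hr_lt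
  have hsub : ball (0 : E) r ⊆ ball 0 ε := ball_subset_ball hrε.le
  have hK' : LipschitzOnWith K A (ball 0 r) := hK.mono fun p hp => (hball p (hsub hp)).2.1
  refine ⟨r, M, L, ⟨hr, hr_one.le, by linarith, fun p hp => ?_, fun p hp => ?_,
    hK'.weaken le_self_add, hL.mono fun p hp => (hball p (hsub hp)).2.2⟩,
    fun p hp => mem_of_mem_nhds (hball p (hsub hp)).1⟩
  · exact (hA.contDiffAt (hball p (hsub hp)).1).differentiableAt (by norm_num)
  · have hp_le : ‖p‖ ≤ 1 := (mem_ball_zero_iff.1 hp).le.trans hr_one.le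
    have hA_sub : ‖A p - A 0‖ ≤ K * ‖p - 0‖ := hK'.norm_sub_le hp (mem_ball_self hr)
    calc ‖A p‖ ≤ ‖A p - A 0‖ + ‖A 0‖ := norm_le_norm_sub_add _ _
      _ ≤ K * 1 + ‖A 0‖ := by
          rw [sub_zero] at hA_sub
          exact add_le_add (hA_sub.trans (by gcongr)) le_rfl
      _ = M := by rw [mul_one, NNReal.coe_add, coe_nnnorm]

theorem exists_isGauge_isUnit [CompleteSpace 𝔸] {A : E → E →L[ℝ] 𝔸} {O : Set E} {p₀ : E}
    (hO : O ∈ 𝓝 p₀) (hA : ContDiffOn ℝ 2 A O) (hflat : IsFlatForm A O) :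
    ∃ r > 0, ball p₀ r ⊆ O ∧ ∃ G : E → 𝔸, IsGauge A G (ball p₀ r) ∧
      ∀ p ∈ ball p₀ r, IsUnit (G p) := by
  let B : E → E →L[ℝ] 𝔸 := fun q => A (p₀ + q)
  have hO' : (p₀ + ·) ⁻¹' O ∈ 𝓝 (0 : E) :=
    (continuous_const_add p₀).continuousAt.preimage_mem_nhds (by rwa [add_zero])
  have hB : ContDiffOn ℝ 2 B ((p₀ + ·) ⁻¹' O) :=
    hA.comp (contDiff_const.add contDiff_id).contDiffOn fun q hq => hq
  obtain ⟨r, M, L, hbounds, hr_sub⟩ := exists_hasGaugeBounds hO' hB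
  obtain ⟨G, hG0, hG⟩ := hbounds.exists_isGauge fun q hq v w => by
    rw [fderiv_comp_add_left p₀]
    exact hflat _ (hr_sub hq) v w
  have sub_mem : ∀ p ∈ ball p₀ r, p - p₀ ∈ ball (0 : E) r := fun p hp =>
    mem_ball_zero_iff.2 (mem_ball_iff_norm.1 hp)
  have hG' : IsGauge A (fun p => G (p - p₀)) (ball p₀ r) := fun p hp => by
    have := (hG _ (sub_mem p hp)).comp p ((hasFDerivAt_id p).sub_const p₀)
    rwa [show B (p - p₀) = A p from congrArg A (add_sub_cancel p₀ p)] at this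
  have hunit : ∀ᶠ p in 𝓝 p₀, IsUnit (G (p - p₀)) := by
    refine (hG' p₀ (mem_ball_self hbounds.radius_pos)).continuousAt.eventually
      (Units.isOpen.mem_nhds ?_)
    simp only [sub_self, hG0, isUnit_one, mem_ofPred_eq]
  obtain ⟨ε, hε, hε_unit⟩ := Metric.eventually_nhds_iff_ball.1 hunit
  refine ⟨min r ε, lt_min hbounds.radius_pos hε, fun p hp => ?_, fun p => G (p - p₀),
    fun p hp => hG' p (ball_subset_ball (min_le_left _ _) hp),
    fun p hp => hε_unit p (ball_subset_ball (min_le_right _ _) hp)⟩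
  simpa using hr_sub (sub_mem p (ball_subset_ball (min_le_left _ _) hp))

end Gauge

/-! ### Smooth trivializations -/

section Trivialization

variable {d : ℕ} {X : Type u} [TopologicalSpace X] [ChartedSpace (EuclideanSpace ℝ (Fin d)) X]

theorem exists_contMDiff_cutoff [T2Space X] [IsManifold (𝓡 d) ∞ X] {W : Set X} {y : X}
    (hW : W ∈ 𝓝 y) :
    ∃ χ : X → ℝ, ContMDiff (𝓡 d) 𝓘(ℝ, ℝ) ∞ χ ∧ tsupport χ ⊆ W ∧ ∀ᶠ z in 𝓝 y, χ z = 1 := by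
  obtain ⟨f, -, hf⟩ := (SmoothBumpFunction.nhds_basis_tsupport (I := 𝓡 d) y).mem_iff.1 hW
  exact ⟨f, f.contMDiff, hf, f.eventuallyEq_one⟩

namespace SmoothVB

variable [IsManifold (𝓡 d) ∞ X]

instance instContMDiffVectorBundleOne (E : SmoothVB.{u, v} d X) :
    ContMDiffVectorBundle 1 E.model E.fiber (𝓡 d) :=
  .of_le (n := ∞) (by norm_cast)

/-- A smooth trivialization of the vector bundle `E` over an open set, given by linear coordinates
on the fibres. For convenience the coordinates are defined on all fibres, but only those over the
base set are subject to a condition. -/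
structure LocalTriv (E : SmoothVB.{u, v} d X) where
  /-- The open set over which the bundle is trivialized. -/
  baseSet : Set X
  isOpen_baseSet : IsOpen baseSet
  /-- The linear coordinates on each fibre. -/
  coord : ∀ y, E.fiber y ≃L[ℝ] E.model
  contMDiffOn_coord : ContMDiffOn ((𝓡 d).prod 𝓘(ℝ, E.model)) 𝓘(ℝ, E.model) ∞
    (fun p : E.Total => coord p.1 p.2) (π E.model E.fiber ⁻¹' baseSet)
  contMDiffOn_coord_symm :
    ContMDiffOn ((𝓡 d).prod 𝓘(ℝ, E.model)) ((𝓡 d).prod 𝓘(ℝ, E.model)) ∞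
      (fun p : X × E.model => (⟨p.1, (coord p.1).symm p.2⟩ : E.Total)) (baseSet ×ˢ univ)

/-- An arbitrary identification of a fibre with the model fibre, used as a junk value outside the
base set of a trivialization. -/
noncomputable def fiberEquiv (E : SmoothVB.{u, v} d X) (y : X) : E.fiber y ≃L[ℝ] E.model :=
  (trivializationAt E.model E.fiber y).continuousLinearEquivAt ℝ y
    (FiberBundle.mem_baseSet_trivializationAt E.model E.fiber y)

open Classical in
/-- The smooth trivialization defined by a trivialization of the bundle atlas. -/
noncomputable def LocalTriv.ofTrivialization (E : SmoothVB.{u, v} d X)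
    (e : Trivialization E.model (π E.model E.fiber)) [MemTrivializationAtlas e] :
    LocalTriv E where
  baseSet := e.baseSet
  isOpen_baseSet := e.open_baseSet
  coord y := if h : y ∈ e.baseSet then e.continuousLinearEquivAt ℝ y h else E.fiberEquiv y
  contMDiffOn_coord := by
    have he := e.contMDiffOn (IB := 𝓡 d) (n := ∞)
    rw [e.source_eq] at he
    refine (contMDiff_snd.comp_contMDiffOn he).congr fun p (hp : p.1 ∈ e.baseSet) => ?_
    simp only [hp, dif_pos]
    rfl
  contMDiffOn_coord_symm := by
    have he := e.contMDiffOn_symm (IB := 𝓡 d) (n := ∞)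
    rw [e.target_eq] at he
    refine he.congr fun p hp => ?_
    have hp' : p.1 ∈ e.baseSet := hp.1
    simp only [hp', dif_pos]
    exact (e.symm_apply_eq_mk_continuousLinearEquivAt_symm p.1 hp' p.2).symm

theorem LocalTriv.ofTrivialization_coord_apply (E : SmoothVB.{u, v} d X)
    (e : Trivialization E.model (π E.model E.fiber)) [MemTrivializationAtlas e] {y : X}
    (hy : y ∈ e.baseSet) (a : E.fiber y) :
    (LocalTriv.ofTrivialization E e).coord y a = (e ⟨y, a⟩).2 := by
  simp [ofTrivialization, hy]

/-- The smooth trivialization around a point given by the preferred bundle trivialization. -/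
noncomputable def localTrivAt (E : SmoothVB.{u, v} d X) (c : X) : LocalTriv E :=
  .ofTrivialization E (trivializationAt E.model E.fiber c)

theorem mem_baseSet_localTrivAt (E : SmoothVB.{u, v} d X) (c : X) : c ∈ (E.localTrivAt c).baseSet :=
  FiberBundle.mem_baseSet_trivializationAt E.model E.fiber c

namespace LocalTriv

variable {E : SmoothVB.{u, v} d X} (t : LocalTriv E)

theorem contMDiffAt_coord {p : E.Total} (hp : p.1 ∈ t.baseSet) :
    ContMDiffAt ((𝓡 d).prod 𝓘(ℝ, E.model)) 𝓘(ℝ, E.model) ∞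
      (fun p : E.Total => t.coord p.1 p.2) p :=
  t.contMDiffOn_coord.contMDiffAt
    ((t.isOpen_baseSet.preimage (FiberBundle.continuous_proj E.model E.fiber)).mem_nhds hp)

theorem contMDiffAt_coord_symm {y : X} (hy : y ∈ t.baseSet) (u : E.model) :
    ContMDiffAt ((𝓡 d).prod 𝓘(ℝ, E.model)) ((𝓡 d).prod 𝓘(ℝ, E.model)) ∞
      (fun p : X × E.model => (⟨p.1, (t.coord p.1).symm p.2⟩ : E.Total)) (y, u) :=
  t.contMDiffOn_coord_symm.contMDiffAt
    ((t.isOpen_baseSet.prod isOpen_univ).mem_nhds ⟨hy, mem_univ _⟩)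

theorem contMDiffAt_section_iff {σ : ∀ y, E.fiber y} {y : X} (hy : y ∈ t.baseSet) {n : ℕ∞ω}
    (hn : n ≤ ∞) :
    ContMDiffAt (𝓡 d) ((𝓡 d).prod 𝓘(ℝ, E.model)) n (fun z => (⟨z, σ z⟩ : E.Total)) y ↔
      ContMDiffAt (𝓡 d) 𝓘(ℝ, E.model) n (fun z => t.coord z (σ z)) y := by
  refine ⟨fun h => ((t.contMDiffAt_coord (p := ⟨y, σ y⟩) hy).of_le hn).comp y h, fun h => ?_⟩
  have hsymm := ((t.contMDiffAt_coord_symm hy (t.coord y (σ y))).of_le hn).comp y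
    (contMDiffAt_id.prodMk h)
  exact hsymm.congr_of_eventuallyEq (.of_forall fun z => by simp)

theorem mdifferentiableAt_section_iff {σ : ∀ y, E.fiber y} {y : X} (hy : y ∈ t.baseSet) :
    MDifferentiableAt (𝓡 d) ((𝓡 d).prod 𝓘(ℝ, E.model)) (fun z => (⟨z, σ z⟩ : E.Total)) y ↔
      MDifferentiableAt (𝓡 d) 𝓘(ℝ, E.model) (fun z => t.coord z (σ z)) y := by
  refine ⟨fun h => ((t.contMDiffAt_coord (p := ⟨y, σ y⟩) hy).mdifferentiableAt (by simp)).comp y h,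
    fun h => ?_⟩
  have hsymm := ((t.contMDiffAt_coord_symm hy (t.coord y (σ y))).mdifferentiableAt (by simp)).comp y
    (mdifferentiableAt_id.prodMk h)
  exact hsymm.congr_of_eventuallyEq (.of_forall fun z => by simp)

theorem exists_isSmoothSection_eventually_coord_eq [T2Space X] {W : Set X} (hW : IsOpen W) {y : X}
    (hy : y ∈ W) (hWt : W ⊆ t.baseSet) {f : X → E.model}
    (hf : ContMDiffOn (𝓡 d) 𝓘(ℝ, E.model) ∞ f W) :
    ∃ σ : ∀ z, E.fiber z, E.IsSmoothSection σ ∧ ∀ᶠ z in 𝓝 y, t.coord z (σ z) = f z := by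
  obtain ⟨χ, hχ, hsupp, hone⟩ := exists_contMDiff_cutoff (d := d) (hW.mem_nhds hy)
  refine ⟨χ • fun z => (t.coord z).symm (f z), ?_, ?_⟩
  · refine ContMDiffOn.smul_section_of_tsupport (n := ∞) (hχ.contMDiffOn (s := W)) hW hsupp
      fun z hz => ContMDiffAt.contMDiffWithinAt ?_
    rw [t.contMDiffAt_section_iff (hWt hz) le_rfl]
    simpa using hf.contMDiffAt (hW.mem_nhds hz)
  · filter_upwards [hone] with z hz
    simp [hz]

/-- The covariant derivative on `t.baseSet` for which the coordinates of the trivialization `t` are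
parallel. -/
noncomputable def flatCov (σ : ∀ y, E.fiber y) (y : X) : TangentSpace (𝓡 d) y →L[ℝ] E.fiber y :=
  ((t.coord y).symm : E.model →L[ℝ] E.fiber y) ∘L mvfderiv (𝓡 d) (fun z => t.coord z (σ z)) y

theorem isCovariantDerivativeOn_flatCov :
    IsCovariantDerivativeOn E.model (I := 𝓡 d) t.flatCov t.baseSet where
  add {σ σ' y} hσ hσ' hy := by
    rw [t.mdifferentiableAt_section_iff hy] at hσ hσ'
    ext v
    simp only [flatCov, Pi.add_apply, map_add, mvfderiv_fun_add hσ hσ']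
    simp
  leibniz {σ g y} hσ hg hy := by
    rw [t.mdifferentiableAt_section_iff hy] at hσ
    ext v
    simp only [flatCov, Pi.smul_apply', map_smul, mvfderiv_fun_smul hg hσ]
    simp

end LocalTriv

end SmoothVB

end Trivialization

/-! ### Derivatives in charts and coordinate vector fields -/

section ChartDeriv

open VectorField

variable {E : Type*} [NormedAddCommGroup E] [NormedSpace ℝ E] {X : Type*} [TopologicalSpace X]
  [ChartedSpace E X] {c y : X}

/-- The derivative at `y` of the chart around `c`. -/
noncomputable def chartDeriv (c y : X) : TangentSpace 𝓘(ℝ, E) y →L[ℝ] E :=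
  mfderiv 𝓘(ℝ, E) 𝓘(ℝ, E) (extChartAt 𝓘(ℝ, E) c) y

theorem eventuallyEq_comp_extChartAt (hy : y ∈ (extChartAt 𝓘(ℝ, E) c).source)
    {H : Type*} (f : X → H) :
    (fun z => f ((extChartAt 𝓘(ℝ, E) c).symm (extChartAt 𝓘(ℝ, E) c z))) =ᶠ[𝓝 y] f := by
  filter_upwards [(isOpen_extChartAt_source c).mem_nhds hy] with z hz
  rw [(extChartAt 𝓘(ℝ, E) c).left_inv hz]

section Function

variable {H : Type*} [NormedAddCommGroup H] [NormedSpace ℝ H]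

theorem mvfderiv_congr {f g : X → H} (h : f =ᶠ[𝓝 y] g) :
    mvfderiv 𝓘(ℝ, E) f y = mvfderiv 𝓘(ℝ, E) g y := by
  ext v
  exact congrArg (fun L => L v) (h.mfderiv_eq (I := 𝓘(ℝ, E)) (I' := 𝓘(ℝ, H)))

theorem mvfderiv_clm_comp {H' : Type*} [NormedAddCommGroup H'] [NormedSpace ℝ H']
    (M : H →L[ℝ] H') {f : X → H} (hf : MDifferentiableAt 𝓘(ℝ, E) 𝓘(ℝ, H) f y)
    (v : TangentSpace 𝓘(ℝ, E) y) :
    mvfderiv 𝓘(ℝ, E) (fun z => M (f z)) y v = M (mvfderiv 𝓘(ℝ, E) f y v) := by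
  have hcomp := mfderiv_comp_apply y (M.mdifferentiableAt (x := f y)) hf v
  rw [mfderiv_eq_fderiv, M.fderiv] at hcomp
  exact hcomp

variable [IsManifold 𝓘(ℝ, E) ∞ X] (hy : y ∈ (extChartAt 𝓘(ℝ, E) c).source)
include hy

theorem contMDiffAt_extChartAt_of_mem_source :
    ContMDiffAt 𝓘(ℝ, E) 𝓘(ℝ, E) ∞ (extChartAt 𝓘(ℝ, E) c) y :=
  contMDiffAt_extChartAt' (by rwa [extChartAt_source] at hy)

theorem mvfderiv_comp_extChartAt {f : E → H}
    (hf : DifferentiableAt ℝ f (extChartAt 𝓘(ℝ, E) c y)) (v : TangentSpace 𝓘(ℝ, E) y) :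
    mvfderiv 𝓘(ℝ, E) (fun z => f (extChartAt 𝓘(ℝ, E) c z)) y v =
      fderiv ℝ f (extChartAt 𝓘(ℝ, E) c y) (chartDeriv c y v) := by
  have hcomp := mfderiv_comp_apply y hf.mdifferentiableAt
    ((contMDiffAt_extChartAt_of_mem_source hy).mdifferentiableAt (by simp)) v
  rw [mfderiv_eq_fderiv] at hcomp
  exact hcomp

theorem contMDiffAt_iff_comp_extChartAt_symm {f : X → H} {n : ℕ∞ω} (hn : n ≤ ∞) :
    ContMDiffAt 𝓘(ℝ, E) 𝓘(ℝ, H) n f y ↔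
      ContDiffAt ℝ n (fun p => f ((extChartAt 𝓘(ℝ, E) c).symm p)) (extChartAt 𝓘(ℝ, E) c y) := by
  have : IsManifold 𝓘(ℝ, E) n X := .of_le hn
  rw [contMDiffAt_iff_source_of_mem_source (x := c) (by rwa [extChartAt_source] at hy)]
  simp only [modelWithCornersSelf_coe, range_id, contMDiffWithinAt_univ,
    contMDiffAt_iff_contDiffAt]
  rfl

theorem differentiableAt_comp_extChartAt_symm {f : X → H}
    (hf : MDifferentiableAt 𝓘(ℝ, E) 𝓘(ℝ, H) f y) :
    DifferentiableAt ℝ (fun p => f ((extChartAt 𝓘(ℝ, E) c).symm p)) (extChartAt 𝓘(ℝ, E) c y) := by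
  have hsymm : ContMDiffAt 𝓘(ℝ, E) 𝓘(ℝ, E) ∞ (extChartAt 𝓘(ℝ, E) c).symm
      (extChartAt 𝓘(ℝ, E) c y) :=
    (contMDiffOn_extChartAt_symm c).contMDiffAt
      ((isOpen_extChartAt_target c).mem_nhds ((extChartAt 𝓘(ℝ, E) c).map_source hy))
  rw [← (extChartAt 𝓘(ℝ, E) c).left_inv hy] at hf
  exact (hf.comp _ (hsymm.mdifferentiableAt (by simp))).differentiableAt

theorem mvfderiv_eq_fderiv_comp_extChartAt_symm {f : X → H}
    (hf : MDifferentiableAt 𝓘(ℝ, E) 𝓘(ℝ, H) f y) (v : TangentSpace 𝓘(ℝ, E) y) :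
    mvfderiv 𝓘(ℝ, E) f y v =
      fderiv ℝ (fun p => f ((extChartAt 𝓘(ℝ, E) c).symm p)) (extChartAt 𝓘(ℝ, E) c y)
        (chartDeriv c y v) := by
  rw [← mvfderiv_comp_extChartAt hy (differentiableAt_comp_extChartAt_symm hy hf),
    mvfderiv_congr (eventuallyEq_comp_extChartAt hy f)]

end Function

theorem mvfderiv_clm_apply {H H' : Type*} [NormedAddCommGroup H] [NormedSpace ℝ H]
    [NormedAddCommGroup H'] [NormedSpace ℝ H'] [IsManifold 𝓘(ℝ, E) ∞ X] {g : X → H →L[ℝ] H'}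
    {f : X → H} (hg : MDifferentiableAt 𝓘(ℝ, E) 𝓘(ℝ, H →L[ℝ] H') g y)
    (hf : MDifferentiableAt 𝓘(ℝ, E) 𝓘(ℝ, H) f y) (v : TangentSpace 𝓘(ℝ, E) y) :
    mvfderiv 𝓘(ℝ, E) (fun z => g z (f z)) y v =
      mvfderiv 𝓘(ℝ, E) g y v (f y) + g y (mvfderiv 𝓘(ℝ, E) f y v) := by
  have hy := mem_extChartAt_source (I := 𝓘(ℝ, E)) y
  have hprod := (differentiableAt_comp_extChartAt_symm hy hg).hasFDerivAt.clm_apply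
    (differentiableAt_comp_extChartAt_symm hy hf).hasFDerivAt
  rw [mvfderiv_eq_fderiv_comp_extChartAt_symm hy hg, mvfderiv_eq_fderiv_comp_extChartAt_symm hy hf,
    mvfderiv_eq_fderiv_comp_extChartAt_symm hy (hg.clm_apply hf), hprod.fderiv]
  simp [add_comm]

/-- The constant vector field on a vector space. -/
def constField (w : E) (z : E) : TangentSpace 𝓘(ℝ, E) z := w

theorem contMDiffAt_constField (w z : E) : ContMDiffAt 𝓘(ℝ, E) 𝓘(ℝ, E).tangent ∞
    (fun z => (⟨z, constField w z⟩ : TangentBundle 𝓘(ℝ, E) E)) z := by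
  rw [contMDiffAt_vectorSpace_iff_contDiffAt]
  exact contDiffAt_const (c := w)

theorem mlieBracket_constField (v w z : E) :
    mlieBracket 𝓘(ℝ, E) (constField v) (constField w) z = 0 := by
  have hbracket : lieBracketWithin ℝ (fun _ : E => v) (fun _ : E => w) univ z = 0 := by
    simp [lieBracketWithin]
  rw [← mlieBracketWithin_univ, mlieBracketWithin_eq_lieBracketWithin]
  exact hbracket

/-- The coordinate vector field with constant components `w` in the chart around `c`. -/
noncomputable def coordField (c : X) (w : E) (y : X) : TangentSpace 𝓘(ℝ, E) y :=
  mpullback 𝓘(ℝ, E) 𝓘(ℝ, E) (extChartAt 𝓘(ℝ, E) c) (constField w) y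

theorem coordField_add (c : X) (w w' : E) (y : X) :
    coordField c (w + w') y = coordField c w y + coordField c w' y :=
  map_add (mfderiv 𝓘(ℝ, E) 𝓘(ℝ, E) (extChartAt 𝓘(ℝ, E) c) y).inverse w w'

theorem coordField_smul (c : X) (a : ℝ) (w : E) (y : X) :
    coordField c (a • w) y = a • coordField c w y :=
  map_smul (mfderiv 𝓘(ℝ, E) 𝓘(ℝ, E) (extChartAt 𝓘(ℝ, E) c) y).inverse a w

variable [IsManifold 𝓘(ℝ, E) ∞ X]

theorem isManifold_minSmoothness (n : ℕ) : IsManifold 𝓘(ℝ, E) (minSmoothness ℝ n) X :=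
  .of_le (n := ∞) (by simp only [minSmoothness_of_isRCLikeNormedField]; norm_cast; simp)

variable (hy : y ∈ (extChartAt 𝓘(ℝ, E) c).source)
include hy

theorem chartDeriv_coordField (w : E) : chartDeriv c y (coordField c w y) = w :=
  (isInvertible_mfderiv_extChartAt hy).self_apply_inverse w

theorem coordField_chartDeriv (v : TangentSpace 𝓘(ℝ, E) y) :
    coordField c (chartDeriv c y v) y = v :=
  (isInvertible_mfderiv_extChartAt hy).inverse_apply_self v

variable [CompleteSpace E]

theorem contMDiffAt_coordField (w : E) :
    ContMDiffAt 𝓘(ℝ, E) 𝓘(ℝ, E).tangent ∞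
      (fun z => (⟨z, coordField c w z⟩ : TangentBundle 𝓘(ℝ, E) X)) y :=
  ContMDiffAt.mpullback_vectorField_preimage (n := ∞) (contMDiffAt_constField w _)
    (contMDiffAt_extChartAt_of_mem_source hy) (isInvertible_mfderiv_extChartAt hy) (by norm_cast)

theorem mlieBracket_coordField (v w : E) :
    mlieBracket 𝓘(ℝ, E) (coordField (X := X) c v) (coordField c w) y = 0 := by
  have : IsManifold 𝓘(ℝ, E) (minSmoothness ℝ 2) X := isManifold_minSmoothness 2
  have : IsManifold 𝓘(ℝ, E) (minSmoothness ℝ 3) X := isManifold_minSmoothness 3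
  have hdiff (w : E) : MDifferentiableAt 𝓘(ℝ, E) 𝓘(ℝ, E).tangent
      (fun z : E => (⟨z, constField w z⟩ : TangentBundle 𝓘(ℝ, E) E)) (extChartAt 𝓘(ℝ, E) c y) :=
    (contMDiffAt_constField w _).mdifferentiableAt (by simp)
  have hpull := mpullback_mlieBracket (I := 𝓘(ℝ, E)) (n := ∞) (hdiff v) (hdiff w)
    (contMDiffAt_extChartAt_of_mem_source hy)
    (by simp only [minSmoothness_of_isRCLikeNormedField]; norm_cast)
  refine hpull.symm.trans ?_
  rw [mpullback_apply, mlieBracket_constField, map_zero]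

end ChartDeriv

theorem exists_isSmoothVectorField_eventually_eq_coordField {d : ℕ} {X : Type u}
    [TopologicalSpace X] [ChartedSpace (EuclideanSpace ℝ (Fin d)) X] [IsManifold (𝓡 d) ∞ X]
    [T2Space X] {c y : X} (hy : y ∈ (extChartAt (𝓡 d) c).source) (w : EuclideanSpace ℝ (Fin d)) :
    ∃ Y : ∀ z : X, TangentSpace (𝓡 d) z, SmoothVB.IsSmoothVectorField Y ∧
      ∀ᶠ z in 𝓝 y, Y z = coordField c w z := by
  have hsource := isOpen_extChartAt_source (I := 𝓡 d) c
  obtain ⟨χ, hχ, hsupp, hone⟩ := exists_contMDiff_cutoff (d := d) (hsource.mem_nhds hy)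
  refine ⟨χ • coordField c w, ?_, ?_⟩
  · exact ContMDiffOn.smul_section_of_tsupport (n := ∞) hχ.contMDiffOn hsource hsupp
      fun z hz => (contMDiffAt_coordField hz w).contMDiffWithinAt
  · filter_upwards [hone] with z hz
    simp [hz]

/-! ### Flat connections in local coordinates -/

namespace FlatVB

open VectorField

variable {d : ℕ} {X : Type u} [TopologicalSpace X]
  [ChartedSpace (EuclideanSpace ℝ (Fin d)) X] [IsManifold (𝓡 d) ∞ X]
  {E : FlatVB.{u, v} d X} (t : SmoothVB.LocalTriv E.bundle)

theorem isSmoothSection_nabla {σ : ∀ y, E.bundle.fiber y} (hσ : E.bundle.IsSmoothSection σ)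
    {Y : ∀ y : X, TangentSpace (𝓡 d) y} (hY : SmoothVB.IsSmoothVectorField Y) :
    E.bundle.IsSmoothSection (fun z => E.nabla σ z (Y z)) := by
  have hnabla := E.smooth.contMDiff.contMDiff (σ := σ) hσ.contMDiffOn
  rw [contMDiffOn_univ] at hnabla
  exact ContMDiff.clm_bundle_apply hnabla hY

/-- The connection form of a trivialization: the difference between the given connection and the one
for which the trivialization is parallel. -/
noncomputable def connForm (y : X) :
    E.bundle.fiber y →L[ℝ] TangentSpace (𝓡 d) y →L[ℝ] E.bundle.fiber y :=
  (E.nabla.isCovariantDerivativeOn (s := t.baseSet)).difference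
    t.isCovariantDerivativeOn_flatCov y

theorem coord_nabla {σ : ∀ y, E.bundle.fiber y} {y : X} (hy : y ∈ t.baseSet)
    (hσ : MDifferentiableAt (𝓡 d) ((𝓡 d).prod 𝓘(ℝ, E.bundle.model))
      (fun z => (⟨z, σ z⟩ : E.bundle.Total)) y) (v : TangentSpace (𝓡 d) y) :
    t.coord y (E.nabla σ y v) =
      mvfderiv (𝓡 d) (fun z => t.coord z (σ z)) y v + t.coord y (connForm t y (σ y) v) := by
  rw [connForm, (E.nabla.isCovariantDerivativeOn (s := t.baseSet)).difference_apply
    t.isCovariantDerivativeOn_flatCov hy hσ]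
  simp [SmoothVB.LocalTriv.flatCov]

/-- The value at `y` of the connection form of a trivialization in the coordinates of the chart
around `c`. -/
noncomputable def connCoordAt (c y : X) :
    EuclideanSpace ℝ (Fin d) →L[ℝ] (E.bundle.model →L[ℝ] E.bundle.model) :=
  LinearMap.toContinuousLinearMap <|
    (LinearMap.toContinuousLinearMap (𝕜 := ℝ) (E := E.bundle.model)
      (F' := E.bundle.model)).toLinearMap ∘ₗ
    LinearMap.mk₂ ℝ (fun w u => t.coord y (connForm t y ((t.coord y).symm u) (coordField c w y)))
      (fun w w' u => by rw [coordField_add, map_add, map_add])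
      (fun a w u => by rw [coordField_smul, map_smul, map_smul])
      (fun w u u' => by rw [map_add, map_add, add_apply, map_add])
      (fun a w u => by rw [map_smul, map_smul, smul_apply, map_smul])

/-- The connection form of a trivialization in the coordinates of the chart around `c`, as a
one-form on the model space with values in the algebra of endomorphisms of the model fibre. -/
noncomputable def connCoord (c : X) (p : EuclideanSpace ℝ (Fin d)) :
    EuclideanSpace ℝ (Fin d) →L[ℝ] (E.bundle.model →L[ℝ] E.bundle.model) :=
  connCoordAt t c ((extChartAt (𝓡 d) c).symm p)

/-- The domain of the connection form in the coordinates of the chart around `c`. -/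
def coordDomain (c : X) : Set (EuclideanSpace ℝ (Fin d)) :=
  extChartAt (𝓡 d) c '' ((extChartAt (𝓡 d) c).source ∩ t.baseSet)

theorem isOpen_coordDomain (c : X) : IsOpen (coordDomain t c) := by
  rw [coordDomain, PartialEquiv.image_source_inter_eq']
  exact (continuousOn_extChartAt_symm c).isOpen_inter_preimage (isOpen_extChartAt_target c)
    t.isOpen_baseSet

section Coordinates

variable {t} {c y : X} (hyc : y ∈ (extChartAt (𝓡 d) c).source)
include hyc

theorem connCoord_apply (w : EuclideanSpace ℝ (Fin d)) (u : E.bundle.model) :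
    connCoord t c (extChartAt (𝓡 d) c y) w u =
      t.coord y (connForm t y ((t.coord y).symm u) (coordField c w y)) := by
  rw [connCoord, (extChartAt (𝓡 d) c).left_inv hyc]
  rfl

variable (hy : y ∈ t.baseSet) {σ : ∀ y, E.bundle.fiber y}
include hy

theorem coord_nabla_eq_connCoord
    (hσ : MDifferentiableAt (𝓡 d) ((𝓡 d).prod 𝓘(ℝ, E.bundle.model))
      (fun z => (⟨z, σ z⟩ : E.bundle.Total)) y) (v : TangentSpace (𝓡 d) y) :
    t.coord y (E.nabla σ y v) =
      mvfderiv (𝓡 d) (fun z => t.coord z (σ z)) y v +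
        connCoord t c (extChartAt (𝓡 d) c y) (chartDeriv c y v) (t.coord y (σ y)) := by
  rw [coord_nabla t hy hσ, connCoord_apply hyc, coordField_chartDeriv hyc,
    ContinuousLinearEquiv.symm_apply_apply]

variable (hσ : E.bundle.IsSmoothSection σ) {W : ∀ y : X, TangentSpace (𝓡 d) y}
  {u : E.bundle.model} {w : EuclideanSpace ℝ (Fin d)}
  (hσu : ∀ᶠ z in 𝓝 y, t.coord z (σ z) = u) (hWw : ∀ᶠ z in 𝓝 y, W z = coordField c w z)
include hσ hσu hWw

theorem eventually_coord_nabla_eq :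
    ∀ᶠ z in 𝓝 y, t.coord z (E.nabla σ z (W z)) = connCoord t c (extChartAt (𝓡 d) c z) w u := by
  filter_upwards [hσu.eventually_nhds, hWw, t.isOpen_baseSet.mem_nhds hy,
    (isOpen_extChartAt_source c).mem_nhds hyc] with z hzu hzw hz hzc
  rw [coord_nabla_eq_connCoord hzc hz ((hσ z).mdifferentiableAt (by simp)), hzu.self_of_nhds, hzw,
    chartDeriv_coordField hzc, mvfderiv_congr hzu]
  simp [mvfderiv_const]

theorem coord_nabla_nabla (hW : SmoothVB.IsSmoothVectorField W)
    (hdiff : DifferentiableAt ℝ (connCoord t c) (extChartAt (𝓡 d) c y))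
    (v : TangentSpace (𝓡 d) y) :
    t.coord y (E.nabla (fun z => E.nabla σ z (W z)) y v) =
      fderiv ℝ (connCoord t c) (extChartAt (𝓡 d) c y) (chartDeriv c y v) w u +
        connCoord t c (extChartAt (𝓡 d) c y) (chartDeriv c y v)
          (connCoord t c (extChartAt (𝓡 d) c y) w u) := by
  have hnabla := eventually_coord_nabla_eq hyc hy hσ hσu hWw
  have hderiv : HasFDerivAt (fun q => connCoord t c q w u) _ (extChartAt (𝓡 d) c y) :=
    (hdiff.hasFDerivAt.clm_apply (hasFDerivAt_const w _)).clm_apply (hasFDerivAt_const u _)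
  rw [coord_nabla_eq_connCoord hyc hy ((isSmoothSection_nabla hσ hW y).mdifferentiableAt (by simp)),
    mvfderiv_congr hnabla, hnabla.self_of_nhds,
    mvfderiv_comp_extChartAt hyc hderiv.differentiableAt, hderiv.fderiv]
  simp

end Coordinates

variable [T2Space X] {c y : X} (hyc : y ∈ (extChartAt (𝓡 d) c).source)

variable {t} in
theorem exists_isSmoothSection_eventually_coord_const (hy : y ∈ t.baseSet) (u : E.bundle.model) :
    ∃ σ : ∀ z, E.bundle.fiber z, E.bundle.IsSmoothSection σ ∧ ∀ᶠ z in 𝓝 y, t.coord z (σ z) = u :=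
  t.exists_isSmoothSection_eventually_coord_eq t.isOpen_baseSet hy subset_rfl contMDiffOn_const

variable {t} in
include hyc in
theorem contDiffAt_connCoord_apply (hy : y ∈ t.baseSet) (w : EuclideanSpace ℝ (Fin d))
    (u : E.bundle.model) :
    ContDiffAt ℝ ∞ (fun p => connCoord t c p w u) (extChartAt (𝓡 d) c y) := by
  obtain ⟨σ, hσ, hσu⟩ := exists_isSmoothSection_eventually_coord_const hy u
  obtain ⟨W, hW, hWw⟩ := exists_isSmoothVectorField_eventually_eq_coordField hyc w
  have hsmooth := (t.contMDiffAt_section_iff hy le_rfl).1 (isSmoothSection_nabla hσ hW y)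
  have hcoord := hsmooth.congr_of_eventuallyEq
    (Filter.EventuallyEq.symm (eventually_coord_nabla_eq hyc hy hσ hσu hWw))
  rw [contMDiffAt_iff_comp_extChartAt_symm hyc le_rfl] at hcoord
  refine hcoord.congr_of_eventuallyEq ?_
  filter_upwards [(isOpen_extChartAt_target c).mem_nhds ((extChartAt (𝓡 d) c).map_source hyc)]
    with p hp
  rw [(extChartAt (𝓡 d) c).right_inv hp]

theorem contDiffOn_connCoord (c : X) : ContDiffOn ℝ ∞ (connCoord t c) (coordDomain t c) := by
  refine contDiffOn_clm_apply.2 fun w => contDiffOn_clm_apply.2 fun u => ?_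
  rintro _ ⟨y, ⟨hyc, hy⟩, rfl⟩
  exact (contDiffAt_connCoord_apply hyc hy w u).contDiffWithinAt

theorem isFlatForm_connCoord (c : X) : IsFlatForm (connCoord t c) (coordDomain t c) := by
  intro p hp v w
  have hdiff := ((contDiffOn_connCoord t c).contDiffAt
    ((isOpen_coordDomain t c).mem_nhds hp)).differentiableAt (by simp)
  obtain ⟨y, ⟨hyc, hy⟩, rfl⟩ := hp
  ext1 u
  obtain ⟨σ, hσ, hσu⟩ := exists_isSmoothSection_eventually_coord_const hy u
  obtain ⟨V, hV, hVv⟩ := exists_isSmoothVectorField_eventually_eq_coordField hyc v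
  obtain ⟨W, hW, hWw⟩ := exists_isSmoothVectorField_eventually_eq_coordField hyc w
  have hbracket : mlieBracket (𝓡 d) V W y = 0 := by
    rw [Filter.EventuallyEq.mlieBracket_vectorField_eq hVv hWw]
    exact mlieBracket_coordField hyc v w
  have hflat := congrArg (t.coord y) (E.flat V W hV hW σ hσ y)
  rw [hbracket, map_zero, sub_zero, map_sub, map_zero,
    coord_nabla_nabla hyc hy hσ hσu hWw hW hdiff, coord_nabla_nabla hyc hy hσ hσu hVv hV hdiff,
    hVv.self_of_nhds, hWw.self_of_nhds, chartDeriv_coordField hyc,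
    chartDeriv_coordField hyc] at hflat
  refine Eq.trans ?_ hflat
  simp only [sub_apply, add_apply, mul_apply_eq_comp]
  abel

end FlatVB

namespace SmoothVB.LocalTriv

variable {d : ℕ} {X : Type u} [TopologicalSpace X]
  [ChartedSpace (EuclideanSpace ℝ (Fin d)) X] [IsManifold (𝓡 d) ∞ X]
  {E : SmoothVB.{u, v} d X} (t : E.LocalTriv) {O : Set X} (hO : IsOpen O) (hOt : O ⊆ t.baseSet)
  {g : X → E.model →L[ℝ] E.model}
  (hg : ContMDiffOn (𝓡 d) 𝓘(ℝ, E.model →L[ℝ] E.model) ∞ g O) (hunit : ∀ y ∈ O, IsUnit (g y))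

open Classical in
/-- The trivialization over an open set `O` whose coordinates are obtained from those of `t` by
applying the inverse of an invertible matrix-valued function `g`. -/
noncomputable def changeFrame : E.LocalTriv where
  baseSet := O
  isOpen_baseSet := hO
  coord y := if h : IsUnit (g y) then
    (t.coord y).trans (ContinuousLinearEquiv.unitsEquiv ℝ E.model h.unit).symm else t.coord y
  contMDiffOn_coord := by
    have hinv : ContMDiffOn ((𝓡 d).prod 𝓘(ℝ, E.model)) 𝓘(ℝ, E.model →L[ℝ] E.model) ∞
        (fun p : E.Total => Ring.inverse (g p.1)) (π E.model E.fiber ⁻¹' O) := by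
      intro p hp
      obtain ⟨w, hw⟩ := hunit p.1 hp
      have hinvAt := (contDiffAt_ringInverse ℝ (n := ∞) w).contMDiffAt
      rw [hw] at hinvAt
      exact (hinvAt.comp p ((hg.contMDiffAt (hO.mem_nhds hp)).comp p
        (contMDiff_proj E.fiber).contMDiffAt)).contMDiffWithinAt
    refine (hinv.clm_apply (t.contMDiffOn_coord.mono (preimage_mono hOt))).congr fun p hp => ?_
    simp only [hunit p.1 hp, dif_pos, Ring.inverse_of_isUnit (hunit p.1 hp)]
    rfl
  contMDiffOn_coord_symm := by
    have hmul : ContMDiffOn ((𝓡 d).prod 𝓘(ℝ, E.model)) ((𝓡 d).prod 𝓘(ℝ, E.model)) ∞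
        (fun p : X × E.model => (p.1, g p.1 p.2)) (O ×ˢ univ) :=
      contMDiffOn_fst.prodMk ((hg.comp contMDiffOn_fst fun p hp => hp.1).clm_apply contMDiffOn_snd)
    refine (t.contMDiffOn_coord_symm.comp hmul fun p hp => ⟨hOt hp.1, mem_univ _⟩).congr
      fun p hp => ?_
    simp only [hunit p.1 hp.1, dif_pos, Function.comp]
    rfl

theorem apply_changeFrame_coord {y : X} (hy : y ∈ O) (a : E.fiber y) :
    g y ((t.changeFrame hO hOt hg hunit).coord y a) = t.coord y a := by
  simp only [changeFrame, hunit y hy, dif_pos]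
  exact (ContinuousLinearEquiv.unitsEquiv ℝ E.model (hunit y hy).unit).apply_symm_apply _

end SmoothVB.LocalTriv

namespace FlatVB

variable {d : ℕ} {X : Type u} [TopologicalSpace X]
  [ChartedSpace (EuclideanSpace ℝ (Fin d)) X] [IsManifold (𝓡 d) ∞ X] {E : FlatVB.{u, v} d X}

/-- A trivialization is flat if it identifies the connection with the exterior derivative. -/
def IsFlatTriv (E : FlatVB.{u, v} d X) (t : E.bundle.LocalTriv) : Prop :=
  ∀ (σ : ∀ y, E.bundle.fiber y) (y : X), y ∈ t.baseSet →
    MDifferentiableAt (𝓡 d) ((𝓡 d).prod 𝓘(ℝ, E.bundle.model))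
      (fun z => (⟨z, σ z⟩ : E.bundle.Total)) y →
    ∀ v, t.coord y (E.nabla σ y v) = mvfderiv (𝓡 d) (fun z => t.coord z (σ z)) y v

theorem isFlatTriv_changeFrame {t : E.bundle.LocalTriv} {c : X} {s : Set (EuclideanSpace ℝ (Fin d))}
    {G : EuclideanSpace ℝ (Fin d) → E.bundle.model →L[ℝ] E.bundle.model}
    (hG : IsGauge (connCoord t c) G s) {O : Set X} (hO : IsOpen O) (hOt : O ⊆ t.baseSet)
    (hOc : O ⊆ (extChartAt (𝓡 d) c).source) (hOs : MapsTo (extChartAt (𝓡 d) c) O s)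
    (hg : ContMDiffOn (𝓡 d) 𝓘(ℝ, E.bundle.model →L[ℝ] E.bundle.model) ∞
      (fun y => G (extChartAt (𝓡 d) c y)) O)
    (hunit : ∀ y ∈ O, IsUnit (G (extChartAt (𝓡 d) c y))) :
    E.IsFlatTriv (t.changeFrame hO hOt hg hunit) := by
  intro σ y hy hσ v
  set t' := t.changeFrame hO hOt hg hunit
  have hcoord {z : X} (hz : z ∈ O) (a : E.bundle.fiber z) :
      G (extChartAt (𝓡 d) c z) (t'.coord z a) = t.coord z a :=
    t.apply_changeFrame_coord hO hOt hg hunit hz a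
  obtain ⟨w, hw⟩ := hunit y hy
  have hinj : Function.Injective (G (extChartAt (𝓡 d) c y)) :=
    hw ▸ (ContinuousLinearEquiv.unitsEquiv ℝ _ w).injective
  have heq : (fun z => t.coord z (σ z)) =ᶠ[𝓝 y]
      fun z => G (extChartAt (𝓡 d) c z) (t'.coord z (σ z)) := by
    filter_upwards [hO.mem_nhds hy] with z hz
    rw [hcoord hz]
  refine hinj ?_
  rw [hcoord hy, coord_nabla_eq_connCoord (hOc hy) (hOt hy) hσ, ← hcoord hy (σ y),
    mvfderiv_congr heq,
    mvfderiv_clm_apply ((hg.contMDiffAt (hO.mem_nhds hy)).mdifferentiableAt (by simp))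
      ((t'.mdifferentiableAt_section_iff hy).1 hσ),
    mvfderiv_comp_extChartAt (hOc hy) ((hG _ (hOs hy)).differentiableAt),
    hG.fderiv_apply (hOs hy)]
  simp only [neg_apply, mul_apply_eq_comp]
  abel

theorem exists_isFlatTriv [T2Space X] (E : FlatVB.{u, v} d X) (c : X) :
    ∃ t : E.bundle.LocalTriv, c ∈ t.baseSet ∧ E.IsFlatTriv t := by
  set t := E.bundle.localTrivAt c
  set ψ := extChartAt (𝓡 d) c
  have hc : ψ c ∈ coordDomain t c :=
    mem_image_of_mem ψ ⟨mem_extChartAt_source c, E.bundle.mem_baseSet_localTrivAt c⟩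
  obtain ⟨r, hr, hball, G, hG, hunit⟩ := exists_isGauge_isUnit
    ((isOpen_coordDomain t c).mem_nhds hc) ((contDiffOn_connCoord t c).of_le (by norm_cast))
    (isFlatForm_connCoord t c)
  have hGsmooth := hG.contDiffOn Metric.isOpen_ball ((contDiffOn_connCoord t c).mono hball)
  have hO : IsOpen (ψ.source ∩ ψ ⁻¹' Metric.ball (ψ c) r) :=
    (continuousOn_extChartAt c).isOpen_inter_preimage (isOpen_extChartAt_source c)
      Metric.isOpen_ball
  have hOt : ψ.source ∩ ψ ⁻¹' Metric.ball (ψ c) r ⊆ t.baseSet := by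
    rintro y ⟨hyc, hy⟩
    obtain ⟨z, ⟨hzc, hz⟩, hzy⟩ := hball hy
    rwa [← ψ.injOn hzc hyc hzy]
  have hg : ContMDiffOn (𝓡 d) 𝓘(ℝ, E.bundle.model →L[ℝ] E.bundle.model) ∞ (fun y => G (ψ y))
      (ψ.source ∩ ψ ⁻¹' Metric.ball (ψ c) r) := fun y hy =>
    ((hGsmooth.contDiffAt (Metric.isOpen_ball.mem_nhds hy.2)).contMDiffAt.comp y
      (contMDiffAt_extChartAt_of_mem_source hy.1)).contMDiffWithinAt
  exact ⟨t.changeFrame hO hOt hg fun y hy => hunit _ hy.2,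
    ⟨mem_extChartAt_source c, Metric.mem_ball_self hr⟩,
    isFlatTriv_changeFrame hG hO hOt (fun _ hy => hy.1) (fun _ hy => hy.2) hg _⟩

end FlatVB

/-! ### Parallel sections -/

theorem eventually_eq_of_mvfderiv_eq_zero {E : Type*} [NormedAddCommGroup E] [NormedSpace ℝ E]
    {X : Type*} [TopologicalSpace X] [ChartedSpace E X] [IsManifold 𝓘(ℝ, E) ∞ X] {y : X}
    {H : Type*} [NormedAddCommGroup H] [NormedSpace ℝ H] {f : X → H}
    (hf : ∀ᶠ z in 𝓝 y, MDifferentiableAt 𝓘(ℝ, E) 𝓘(ℝ, H) f z ∧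
      ∀ v, mvfderiv 𝓘(ℝ, E) f z v = 0) : ∀ᶠ z in 𝓝 y, f z = f y := by
  set ψ := extChartAt 𝓘(ℝ, E) y
  have hy : y ∈ ψ.source := mem_extChartAt_source y
  have hsymm : Filter.Tendsto ψ.symm (𝓝 (ψ y)) (𝓝 y) := by
    simpa only [ContinuousAt, ψ, extChartAt_to_inv] using
      continuousAt_extChartAt_symm (I := 𝓘(ℝ, E)) y
  have hderiv : ∀ᶠ p in 𝓝 (ψ y), HasFDerivAt (fun p => f (ψ.symm p)) (0 : E →L[ℝ] H) p := by
    filter_upwards [(isOpen_extChartAt_target y).mem_nhds (ψ.map_source hy), hsymm.eventually hf]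
      with p hp ⟨hd, hzero⟩
    have hs := ψ.map_target hp
    have hdiff := differentiableAt_comp_extChartAt_symm hs hd
    have hfderiv := mvfderiv_eq_fderiv_comp_extChartAt_symm hs hd
    rw [ψ.right_inv hp] at hdiff hfderiv
    convert hdiff.hasFDerivAt using 1
    ext w
    have hw := hfderiv (coordField y w (ψ.symm p))
    rwa [chartDeriv_coordField hs, hzero] at hw
  obtain ⟨r, hr, hball⟩ := Metric.eventually_nhds_iff_ball.1 hderiv
  filter_upwards [(isOpen_extChartAt_source y).mem_nhds hy,
    (continuousAt_extChartAt (I := 𝓘(ℝ, E)) y).eventually (Metric.ball_mem_nhds _ hr)] with z hz hzr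
  have hconst : f (ψ.symm (ψ z)) = f (ψ.symm (ψ y)) :=
    Metric.isOpen_ball.is_const_of_fderiv_eq_zero (𝕜 := ℝ)
      (convex_ball (ψ y) r).isPreconnected
      (fun p hp => (hball p hp).differentiableAt.differentiableWithinAt)
      (fun p hp => (hball p hp).fderiv) hzr (Metric.mem_ball_self hr)
  rwa [ψ.left_inv hz, ψ.left_inv hy] at hconst

namespace SmoothVB

variable {d : ℕ} {X : Type u} [TopologicalSpace X]
    [ChartedSpace (EuclideanSpace ℝ (Fin d)) X] [IsManifold (𝓡 d) ∞ X]
    {E E' : SmoothVB.{u, v} d X}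

theorem continuous_fiber_linearMap {y : X} (f : E.fiber y →ₗ[ℝ] E'.fiber y) : Continuous f := by
  have : FiniteDimensional ℝ (E.fiber y) := (E.fiberEquiv y).symm.toLinearEquiv.finiteDimensional
  have : T2Space (E.fiber y) := (E.fiberEquiv y).symm.toHomeomorph.t2Space
  exact f.continuous_of_finiteDimensional

theorem contMDiffAt_app_of_eventually_coord_eq {φ : ∀ y, E.fiber y →L[ℝ] E'.fiber y}
    (t : E.LocalTriv) (t' : E'.LocalTriv) {p : E.Total} (hp : p.1 ∈ t.baseSet)
    (hp' : p.1 ∈ t'.baseSet) {M : E.model →L[ℝ] E'.model}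
    (h : ∀ᶠ z in 𝓝 p.1, ∀ a, t'.coord z (φ z a) = M (t.coord z a)) :
    ContMDiffAt ((𝓡 d).prod 𝓘(ℝ, E.model)) ((𝓡 d).prod 𝓘(ℝ, E'.model)) ∞
      (fun q : E.Total => (⟨q.1, φ q.1 q.2⟩ : E'.Total)) p := by
  have hM : ContMDiffAt ((𝓡 d).prod 𝓘(ℝ, E.model)) ((𝓡 d).prod 𝓘(ℝ, E'.model)) ∞
      (fun q : E.Total => (q.1, M (t.coord q.1 q.2))) p :=
    (contMDiff_proj E.fiber).contMDiffAt.prodMk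
      (M.contMDiff.contMDiffAt.comp p (t.contMDiffAt_coord hp))
  refine ((t'.contMDiffAt_coord_symm hp' (M (t.coord p.1 p.2))).comp p hM).congr_of_eventuallyEq ?_
  filter_upwards [(FiberBundle.continuous_proj E.model E.fiber).continuousAt.eventually h] with q hq
  simp only [Function.comp, ← hq, ContinuousLinearEquiv.symm_apply_apply]

end SmoothVB

namespace FlatVB

variable {d : ℕ} {X : Type u} [TopologicalSpace X]
    [ChartedSpace (EuclideanSpace ℝ (Fin d)) X] [IsManifold (𝓡 d) ∞ X]
    {E E' : FlatVB.{u, v} d X} {t : E.bundle.LocalTriv} {t' : E'.bundle.LocalTriv}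

theorem IsFlatTriv.nabla_eq_zero (ht : E.IsFlatTriv t) {σ : ∀ y, E.bundle.fiber y} {y : X}
    (hy : y ∈ t.baseSet) (hσ : E.bundle.IsSmoothSection σ) {u : E.bundle.model}
    (hu : ∀ᶠ z in 𝓝 y, t.coord z (σ z) = u) : E.nabla σ y = 0 := by
  ext v
  refine (t.coord y).injective ?_
  rw [ht σ y hy ((hσ y).mdifferentiableAt (by simp)) v, mvfderiv_congr hu, mvfderiv_const]
  simp

theorem IsFlatTriv.eventually_coord_eq (ht : E.IsFlatTriv t) {σ : ∀ y, E.bundle.fiber y} {y : X}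
    (hy : y ∈ t.baseSet) (hσ : E.bundle.IsSmoothSection σ)
    (hparallel : ∀ᶠ z in 𝓝 y, E.nabla σ z = 0) :
    ∀ᶠ z in 𝓝 y, t.coord z (σ z) = t.coord y (σ y) := by
  refine eventually_eq_of_mvfderiv_eq_zero (E := EuclideanSpace ℝ (Fin d)) ?_
  filter_upwards [t.isOpen_baseSet.mem_nhds hy, hparallel] with z hz hzero
  have hσz : MDifferentiableAt (𝓡 d) ((𝓡 d).prod 𝓘(ℝ, E.bundle.model))
      (fun z => (⟨z, σ z⟩ : E.bundle.Total)) z := (hσ z).mdifferentiableAt (by simp)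
  refine ⟨(t.mdifferentiableAt_section_iff hz).1 hσz, fun v => ?_⟩
  rw [← ht σ z hz hσz, hzero]
  exact map_zero (t.coord z)

theorem IsFlatTriv.nabla_app_eq (ht : E.IsFlatTriv t) (ht' : E'.IsFlatTriv t')
    {φ : ∀ y, E.bundle.fiber y →L[ℝ] E'.bundle.fiber y} {y : X} (hy : y ∈ t.baseSet)
    (hy' : y ∈ t'.baseSet) {M : E.bundle.model →L[ℝ] E'.bundle.model}
    (hM : ∀ᶠ z in 𝓝 y, ∀ a, t'.coord z (φ z a) = M (t.coord z a))
    {σ : ∀ y, E.bundle.fiber y} (hσ : E.bundle.IsSmoothSection σ) :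
    E'.nabla (fun z => φ z (σ z)) y = (φ y).comp (E.nabla σ y) := by
  have hσy : MDifferentiableAt (𝓡 d) ((𝓡 d).prod 𝓘(ℝ, E.bundle.model))
      (fun z => (⟨z, σ z⟩ : E.bundle.Total)) y := (hσ y).mdifferentiableAt (by simp)
  have hcoord := (t.mdifferentiableAt_section_iff hy).1 hσy
  have hφσ : (fun z => t'.coord z (φ z (σ z))) =ᶠ[𝓝 y] fun z => M (t.coord z (σ z)) :=
    hM.mono fun z hz => hz (σ z)
  have hφσy := (t'.mdifferentiableAt_section_iff (σ := fun z => φ z (σ z)) hy').2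
    ((M.mdifferentiableAt.comp y hcoord).congr_of_eventuallyEq hφσ)
  ext v
  refine (t'.coord y).injective ?_
  rw [ht' _ y hy' hφσy, mvfderiv_congr hφσ, mvfderiv_clm_comp M hcoord, ← ht σ y hy hσy,
    ContinuousLinearMap.comp_apply, hM.self_of_nhds]

variable [T2Space X]

theorem eventually_coord_hom_eq (φ : E ⟶ E') (ht : E.IsFlatTriv t) (ht' : E'.IsFlatTriv t') {y : X}
    (hy : y ∈ t.baseSet) (hy' : y ∈ t'.baseSet) (u : E.bundle.model) :
    ∀ᶠ z in 𝓝 y, t'.coord z (φ.hom.app z ((t.coord z).symm u)) =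
      t'.coord y (φ.hom.app y ((t.coord y).symm u)) := by
  obtain ⟨σ, hσ, hu⟩ := exists_isSmoothSection_eventually_coord_const hy u
  have hσu : ∀ᶠ z in 𝓝 y, σ z = (t.coord z).symm u :=
    hu.mono fun z hz => by rw [← hz, ContinuousLinearEquiv.symm_apply_apply]
  have hparallel : ∀ᶠ z in 𝓝 y, E'.nabla (fun z => φ.hom.app z (σ z)) z = 0 := by
    filter_upwards [t.isOpen_baseSet.mem_nhds hy, hu.eventually_nhds] with z hz hzu
    rw [φ.compatible σ hσ, ht.nabla_eq_zero hz hσ hzu, ContinuousLinearMap.comp_zero]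
  filter_upwards [ht'.eventually_coord_eq hy' (φ.hom.smooth.comp hσ) hparallel, hσu] with z hz hzu
  rw [← hzu, hz, hσu.self_of_nhds]

theorem eventually_forall_coord_hom_eq (φ : E ⟶ E') (ht : E.IsFlatTriv t) (ht' : E'.IsFlatTriv t')
    {y : X} (hy : y ∈ t.baseSet) (hy' : y ∈ t'.baseSet) :
    ∀ᶠ z in 𝓝 y, ∀ u, t'.coord z (φ.hom.app z ((t.coord z).symm u)) =
      t'.coord y (φ.hom.app y ((t.coord y).symm u)) := by
  let b := Module.finBasis ℝ E.bundle.model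
  let L (z : X) : E.bundle.model →ₗ[ℝ] E'.bundle.model :=
    (t'.coord z).toLinearMap ∘ₗ (φ.hom.app z).toLinearMap ∘ₗ (t.coord z).symm.toLinearMap
  filter_upwards [Filter.eventually_all.2 fun i => eventually_coord_hom_eq φ ht ht' hy hy' (b i)]
    with z hz
  exact LinearMap.congr_fun (show L z = L y from b.ext hz)

variable (E) in
/-- A chosen flat trivialization around a point. -/
noncomputable def flatTriv (c : X) : E.bundle.LocalTriv := (E.exists_isFlatTriv c).choose

variable (E) in
theorem mem_baseSet_flatTriv (c : X) : c ∈ (E.flatTriv c).baseSet :=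
  (E.exists_isFlatTriv c).choose_spec.1

variable (E) in
theorem isFlatTriv_flatTriv (c : X) : E.IsFlatTriv (E.flatTriv c) :=
  (E.exists_isFlatTriv c).choose_spec.2

variable (E) in
/-- The local system of parallel sections of a flat vector bundle. -/
noncomputable def localSystem : LocalSystem ℝ E.bundle.model E.bundle.fiber where
  baseSet c := (E.flatTriv c).baseSet
  isOpen_baseSet c := (E.flatTriv c).isOpen_baseSet
  mem_baseSet := E.mem_baseSet_flatTriv
  triv c y := ((E.flatTriv c).coord y).toLinearEquiv
  eventually_transition_eq c c' _ hy hy' := eventually_forall_coord_hom_eq (𝟙 E)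
    (E.isFlatTriv_flatTriv c) (E.isFlatTriv_flatTriv c') hy hy'

theorem isMorphism_hom (φ : E ⟶ E') :
    E.localSystem.IsMorphism E'.localSystem fun y => (φ.hom.app y).toLinearMap :=
  fun c c' _ hy hy' => eventually_forall_coord_hom_eq φ
    (E.isFlatTriv_flatTriv c) (E'.isFlatTriv_flatTriv c') hy hy'

theorem exists_eventually_coord_eq_of_isMorphism
    {φ : ∀ y, E.bundle.fiber y →ₗ[ℝ] E'.bundle.fiber y}
    (hφ : E.localSystem.IsMorphism E'.localSystem φ) (y : X) :
    ∃ M : E.bundle.model →L[ℝ] E'.bundle.model, ∀ᶠ z in 𝓝 y, ∀ a,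
      (E'.flatTriv y).coord z (φ z a) = M ((E.flatTriv y).coord z a) := by
  refine ⟨LinearMap.toContinuousLinearMap (((E'.flatTriv y).coord y).toLinearMap ∘ₗ φ y ∘ₗ
    ((E.flatTriv y).coord y).symm.toLinearMap), ?_⟩
  filter_upwards [hφ y y y (E.mem_baseSet_flatTriv y) (E'.mem_baseSet_flatTriv y)] with z hz a
  have ha : ((E.flatTriv y).coord z).symm ((E.flatTriv y).coord z a) = a :=
    ContinuousLinearEquiv.symm_apply_apply _ _
  exact (congrArg (fun a => (E'.flatTriv y).coord z (φ z a)) ha).symm.trans (hz _)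

/-- The morphism of flat bundles defined by a morphism of their local systems. -/
noncomputable def homOfIsMorphism (φ : ∀ y, E.bundle.fiber y →ₗ[ℝ] E'.bundle.fiber y)
    (hφ : E.localSystem.IsMorphism E'.localSystem φ) : E ⟶ E' where
  hom :=
    { app := fun y => ⟨φ y, SmoothVB.continuous_fiber_linearMap (φ y)⟩
      smooth := fun p =>
        have ⟨_, hM⟩ := exists_eventually_coord_eq_of_isMorphism hφ p.1
        SmoothVB.contMDiffAt_app_of_eventually_coord_eq
          (φ := fun y => ⟨φ y, SmoothVB.continuous_fiber_linearMap (φ y)⟩) _ _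
          (E.mem_baseSet_flatTriv p.1) (E'.mem_baseSet_flatTriv p.1) hM }
  compatible _ hσ y :=
    have ⟨_, hM⟩ := exists_eventually_coord_eq_of_isMorphism hφ y
    (E.isFlatTriv_flatTriv y).nabla_app_eq (E'.isFlatTriv_flatTriv y) (E.mem_baseSet_flatTriv y)
      (E'.mem_baseSet_flatTriv y) hM hσ

end FlatVB

/-! ### Flat connections from locally constant transition functions -/

section Commutator

open VectorField

variable {E : Type*} [NormedAddCommGroup E] [NormedSpace ℝ E]
  {X : Type*} [TopologicalSpace X] [ChartedSpace E X] [IsManifold 𝓘(ℝ, E) ∞ X] {y : X}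
  {H : Type*} [NormedAddCommGroup H] [NormedSpace ℝ H] {f : X → H}

/-- The components of a vector field in the chart around `c`, as a function on the model space. -/
noncomputable def fieldCoord (c : X) (Z : ∀ z : X, TangentSpace 𝓘(ℝ, E) z) : E → E :=
  mpullbackWithin 𝓘(ℝ, E) 𝓘(ℝ, E) (extChartAt 𝓘(ℝ, E) c).symm Z (range 𝓘(ℝ, E))

theorem fieldCoord_extChartAt {c z : X} (hz : z ∈ (extChartAt 𝓘(ℝ, E) c).source)
    (Z : ∀ z : X, TangentSpace 𝓘(ℝ, E) z) :
    fieldCoord c Z (extChartAt 𝓘(ℝ, E) c z) = chartDeriv c z (Z z) := by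
  set D := mfderivWithin 𝓘(ℝ, E) 𝓘(ℝ, E) (extChartAt 𝓘(ℝ, E) c).symm (range 𝓘(ℝ, E))
    (extChartAt 𝓘(ℝ, E) c z)
  have hinv : D.IsInvertible := isInvertible_mfderivWithin_extChartAt_symm
    ((extChartAt 𝓘(ℝ, E) c).map_source hz)
  have hZ : ∀ z', z' = z → (Z z' : E) = Z z := by rintro _ rfl; rfl
  exact (congrArg D.inverse (hZ _ ((extChartAt 𝓘(ℝ, E) c).left_inv hz))).trans
    (hinv.inverse_apply_eq.2 (congrArg (fun L => L (Z z))
      (mfderivWithin_extChartAt_symm_comp_mfderiv_extChartAt' (I := 𝓘(ℝ, E)) hz)).symm)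

theorem chartDeriv_mlieBracket (Y Z : ∀ z : X, TangentSpace 𝓘(ℝ, E) z) :
    chartDeriv y y (mlieBracket 𝓘(ℝ, E) Y Z y) =
      lieBracket ℝ (fieldCoord y Y) (fieldCoord y Z) (extChartAt 𝓘(ℝ, E) y y) := by
  have hs : (extChartAt 𝓘(ℝ, E) y).symm ⁻¹' univ ∩ range 𝓘(ℝ, E) = univ := by simp
  rw [← lieBracketWithin_univ, ← hs]
  exact (isInvertible_mfderiv_extChartAt (I := 𝓘(ℝ, E))
    (mem_extChartAt_source y)).self_apply_inverse _

theorem eventually_mdifferentiableAt (hf : ContMDiffAt 𝓘(ℝ, E) 𝓘(ℝ, H) 1 f y) :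
    ∀ᶠ z in 𝓝 y, MDifferentiableAt 𝓘(ℝ, E) 𝓘(ℝ, H) f z :=
  ((contMDiffAt_iff_contMDiffAt_nhds (by simp)).1 hf).mono
    fun _ hz => hz.mdifferentiableAt (by simp)

variable [CompleteSpace E]

theorem differentiableAt_fieldCoord {Z : ∀ z : X, TangentSpace 𝓘(ℝ, E) z}
    (hZ : MDifferentiableAt 𝓘(ℝ, E) 𝓘(ℝ, E).tangent
      (fun z => (⟨z, Z z⟩ : TangentBundle 𝓘(ℝ, E) X)) y) :
    DifferentiableAt ℝ (fieldCoord y Z) (extChartAt 𝓘(ℝ, E) y y) := by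
  have : IsManifold 𝓘(ℝ, E) 2 X := .of_le (n := ∞) (by norm_cast)
  have hpullback := MDifferentiableWithinAt.differentiableWithinAt_mpullbackWithin_vectorField
    hZ.mdifferentiableWithinAt (s := univ)
  have hs : (extChartAt 𝓘(ℝ, E) y).symm ⁻¹' univ ∩ range 𝓘(ℝ, E) = univ := by simp
  rw [hs] at hpullback
  exact differentiableWithinAt_univ.1 hpullback

theorem mvfderiv_mvfderiv_apply (hf : ContMDiffAt 𝓘(ℝ, E) 𝓘(ℝ, H) 2 f y)
    {Z : ∀ z : X, TangentSpace 𝓘(ℝ, E) z}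
    (hZ : MDifferentiableAt 𝓘(ℝ, E) 𝓘(ℝ, E).tangent
      (fun z => (⟨z, Z z⟩ : TangentBundle 𝓘(ℝ, E) X)) y) (v : TangentSpace 𝓘(ℝ, E) y) :
    mvfderiv 𝓘(ℝ, E) (fun z => mvfderiv 𝓘(ℝ, E) f z (Z z)) y v =
      fderiv ℝ (fderiv ℝ fun p => f ((extChartAt 𝓘(ℝ, E) y).symm p)) (extChartAt 𝓘(ℝ, E) y y)
          (chartDeriv y y v) (fieldCoord y Z (extChartAt 𝓘(ℝ, E) y y)) +
        fderiv ℝ (fun p => f ((extChartAt 𝓘(ℝ, E) y).symm p)) (extChartAt 𝓘(ℝ, E) y y)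
          (fderiv ℝ (fieldCoord y Z) (extChartAt 𝓘(ℝ, E) y y) (chartDeriv y y v)) := by
  set ψ := extChartAt 𝓘(ℝ, E) y
  have hy : y ∈ ψ.source := mem_extChartAt_source y
  set g : E → H := fun p => f (ψ.symm p)
  have hg : ContDiffAt ℝ 2 g (ψ y) :=
    (contMDiffAt_iff_comp_extChartAt_symm hy (by norm_cast)).1 hf
  have hg' : DifferentiableAt ℝ (fderiv ℝ g) (ψ y) :=
    (hg.fderiv_right (m := 1) (by norm_num)).differentiableAt (by simp)
  have hcoord : ∀ᶠ z in 𝓝 y, mvfderiv 𝓘(ℝ, E) f z (Z z) =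
      fderiv ℝ g (ψ z) (fieldCoord y Z (ψ z)) := by
    filter_upwards [eventually_mdifferentiableAt (hf.of_le (by norm_num)),
      (isOpen_extChartAt_source y).mem_nhds hy] with z hz hzs
    rw [mvfderiv_eq_fderiv_comp_extChartAt_symm hzs hz, fieldCoord_extChartAt hzs]
  have hproduct := hg'.hasFDerivAt.clm_apply (differentiableAt_fieldCoord hZ).hasFDerivAt
  rw [mvfderiv_congr hcoord, mvfderiv_comp_extChartAt
    (f := fun p => fderiv ℝ g p (fieldCoord y Z p)) hy hproduct.differentiableAt, hproduct.fderiv]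
  simp only [add_apply, ContinuousLinearMap.comp_apply, ContinuousLinearMap.flip_apply]
  exact add_comm _ _

theorem mvfderiv_mvfderiv_sub (hf : ContMDiffAt 𝓘(ℝ, E) 𝓘(ℝ, H) 2 f y)
    {Y Z : ∀ z : X, TangentSpace 𝓘(ℝ, E) z}
    (hY : MDifferentiableAt 𝓘(ℝ, E) 𝓘(ℝ, E).tangent
      (fun z => (⟨z, Y z⟩ : TangentBundle 𝓘(ℝ, E) X)) y)
    (hZ : MDifferentiableAt 𝓘(ℝ, E) 𝓘(ℝ, E).tangent
      (fun z => (⟨z, Z z⟩ : TangentBundle 𝓘(ℝ, E) X)) y) :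
    mvfderiv 𝓘(ℝ, E) (fun z => mvfderiv 𝓘(ℝ, E) f z (Z z)) y (Y y)
      - mvfderiv 𝓘(ℝ, E) (fun z => mvfderiv 𝓘(ℝ, E) f z (Y z)) y (Z y)
      = mvfderiv 𝓘(ℝ, E) f y (mlieBracket 𝓘(ℝ, E) Y Z y) := by
  have hy : y ∈ (extChartAt 𝓘(ℝ, E) y).source := mem_extChartAt_source y
  have hsymm := ((contMDiffAt_iff_comp_extChartAt_symm hy (by norm_cast)).1
    hf).isSymmSndFDerivAt (by simp)
  rw [mvfderiv_mvfderiv_apply hf hZ, mvfderiv_mvfderiv_apply hf hY,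
    mvfderiv_eq_fderiv_comp_extChartAt_symm hy (hf.mdifferentiableAt (by simp)),
    chartDeriv_mlieBracket, lieBracket, map_sub, fieldCoord_extChartAt hy,
    fieldCoord_extChartAt hy, hsymm.eq]
  abel

end Commutator

namespace SmoothVB

variable {d : ℕ} {X : Type u} [TopologicalSpace X]
    [ChartedSpace (EuclideanSpace ℝ (Fin d)) X] [IsManifold (𝓡 d) ∞ X]

/-- The transition functions between the preferred trivializations are locally constant. -/
def HasLocallyConstantTransitions (E : SmoothVB.{u, v} d X) : Prop :=
  ∀ c c' y, y ∈ (E.localTrivAt c).baseSet → y ∈ (E.localTrivAt c').baseSet → ∀ᶠ z in 𝓝 y, ∀ u,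
    (E.localTrivAt c').coord z (((E.localTrivAt c).coord z).symm u) =
      (E.localTrivAt c').coord y (((E.localTrivAt c).coord y).symm u)

/-- The covariant derivative whose value at a point is the exterior derivative in the preferred
trivialization around that point. -/
noncomputable def flatNabla (E : SmoothVB.{u, v} d X) :
    CovariantDerivative (𝓡 d) E.model E.fiber where
  toFun σ y := (E.localTrivAt y).flatCov σ y
  isCovariantDerivativeOnUniv :=
    { add := fun {_ _ y} hσ hσ' _ => (E.localTrivAt y).isCovariantDerivativeOn_flatCov.add hσ hσ'
        (E.mem_baseSet_localTrivAt y)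
      leibniz := fun {_ _ y} hσ hg _ => (E.localTrivAt y).isCovariantDerivativeOn_flatCov.leibniz
        hσ hg (E.mem_baseSet_localTrivAt y) }

namespace HasLocallyConstantTransitions

variable {E : SmoothVB.{u, v} d X} (hE : E.HasLocallyConstantTransitions)
include hE

theorem coord_flatNabla {c y : X} (hy : y ∈ (E.localTrivAt c).baseSet)
    {σ : ∀ y, E.fiber y} (hσ : MDifferentiableAt (𝓡 d) ((𝓡 d).prod 𝓘(ℝ, E.model))
      (fun z => (⟨z, σ z⟩ : E.Total)) y) (v : TangentSpace (𝓡 d) y) :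
    (E.localTrivAt c).coord y (E.flatNabla σ y v) =
      mvfderiv (𝓡 d) (fun z => (E.localTrivAt c).coord z (σ z)) y v := by
  set t := E.localTrivAt c
  set t' := E.localTrivAt y
  let M : E.model →L[ℝ] E.model := (t.coord y : E.fiber y →L[ℝ] E.model) ∘L
    ((t'.coord y).symm : E.model →L[ℝ] E.fiber y)
  have hM : ∀ᶠ z in 𝓝 y, t.coord z (σ z) = M (t'.coord z (σ z)) := by
    filter_upwards [hE y c y (E.mem_baseSet_localTrivAt y) hy] with z hz
    have h := hz (t'.coord z (σ z))
    rw [ContinuousLinearEquiv.symm_apply_apply] at h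
    exact h
  rw [mvfderiv_congr hM, mvfderiv_clm_comp M
    ((t'.mdifferentiableAt_section_iff (E.mem_baseSet_localTrivAt y)).1 hσ)]
  rfl

theorem contMDiff_flatNabla :
    CovariantDerivative.ContMDiffCovariantDerivative E.flatNabla ∞ := by
  refine ⟨⟨fun {σ} hσ => ?_⟩⟩
  rw [contMDiffOn_univ] at hσ ⊢
  have hσ : E.IsSmoothSection σ := hσ
  intro y
  have hcoord := ((E.localTrivAt y).contMDiffAt_section_iff (E.mem_baseSet_localTrivAt y)
    le_rfl).1 (hσ y)
  refine (contMDiffAt_hom_bundle _).2 ⟨contMDiffAt_id,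
    (hcoord.mfderiv_const (m := ∞) (by norm_cast)).congr_of_eventuallyEq ?_⟩
  filter_upwards [(E.localTrivAt y).isOpen_baseSet.mem_nhds (E.mem_baseSet_localTrivAt y)] with z hz
  ext w
  simp only [ContinuousLinearMap.inCoordinates, inTangentCoordinates,
    ContinuousLinearMap.comp_apply, TangentBundle.continuousLinearMapAt_model_space]
  have hnabla := hE.coord_flatNabla hz ((hσ z).mdifferentiableAt (by simp))
    ((trivializationAt (EuclideanSpace ℝ (Fin d)) (TangentSpace (𝓡 d)) y).symmL ℝ z w)
  have hz' : z ∈ (trivializationAt E.model E.fiber y).baseSet := hz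
  rw [localTrivAt, LocalTriv.ofTrivialization_coord_apply _ _ hz'] at hnabla
  rw [Trivialization.continuousLinearMapAt_apply, Trivialization.linearMapAt_apply, if_pos hz']
  exact congrArg (fun u : E.model => u _) hnabla

theorem isSmoothSection_flatNabla {σ : ∀ y, E.fiber y} (hσ : E.IsSmoothSection σ)
    {Y : ∀ y : X, TangentSpace (𝓡 d) y} (hY : IsSmoothVectorField Y) :
    E.IsSmoothSection (fun z => E.flatNabla σ z (Y z)) := by
  have hnabla := hE.contMDiff_flatNabla.contMDiff.contMDiff (σ := σ) (hσ.contMDiffOn)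
  rw [contMDiffOn_univ] at hnabla
  exact ContMDiff.clm_bundle_apply hnabla hY

theorem coord_flatNabla_flatNabla {σ : ∀ y, E.fiber y} (hσ : E.IsSmoothSection σ)
    {Z : ∀ y : X, TangentSpace (𝓡 d) y} (hZ : IsSmoothVectorField Z) {c y : X}
    (hy : y ∈ (E.localTrivAt c).baseSet) (v : TangentSpace (𝓡 d) y) :
    (E.localTrivAt c).coord y (E.flatNabla (fun z => E.flatNabla σ z (Z z)) y v) =
      mvfderiv (𝓡 d) (fun z => mvfderiv (𝓡 d) (fun z => (E.localTrivAt c).coord z (σ z)) z (Z z))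
        y v := by
  rw [hE.coord_flatNabla hy ((hE.isSmoothSection_flatNabla hσ hZ y).mdifferentiableAt (by simp))]
  congr 1
  refine mvfderiv_congr ?_
  filter_upwards [(E.localTrivAt c).isOpen_baseSet.mem_nhds hy] with z hz
  exact hE.coord_flatNabla hz ((hσ z).mdifferentiableAt (by simp)) _

theorem isFlat_flatNabla : E.IsFlat E.flatNabla := by
  intro Y Z hY hZ σ hσ y
  have hy := E.mem_baseSet_localTrivAt y
  refine ((E.localTrivAt y).coord y).injective ?_
  have hcoord := ((E.localTrivAt y).contMDiffAt_section_iff hy le_rfl).1 (hσ y)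
  rw [map_sub, map_sub, map_zero, hE.coord_flatNabla_flatNabla hσ hZ hy,
    hE.coord_flatNabla_flatNabla hσ hY hy,
    mvfderiv_mvfderiv_sub (hcoord.of_le (by norm_cast)) ((hY y).mdifferentiableAt (by simp))
      ((hZ y).mdifferentiableAt (by simp)),
    hE.coord_flatNabla hy ((hσ y).mdifferentiableAt (by simp)), sub_self]

/-- The flat bundle defined by a bundle with locally constant transition functions. -/
noncomputable def toFlatVB : FlatVB.{u, v} d X where
  bundle := E
  nabla := E.flatNabla
  smooth := hE.contMDiff_flatNabla
  flat := hE.isFlat_flatNabla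

theorem isFlatTriv_localTrivAt (c : X) : hE.toFlatVB.IsFlatTriv (E.localTrivAt c) :=
  fun _ _ hy hσ v => hE.coord_flatNabla hy hσ v

end HasLocallyConstantTransitions

end SmoothVB

namespace LocalSystem

variable {d : ℕ} {X : Type u} [TopologicalSpace X] [ChartedSpace (EuclideanSpace ℝ (Fin d)) X]
  {n : ℕ} {V : X → Type v} [∀ y, AddCommGroup (V y)] [∀ y, Module ℝ (V y)]
  (S : LocalSystem ℝ (EuclideanSpace ℝ (Fin n)) V)

/-- The trivializations of a local system, as trivializations of its total space. -/
def pretriv (c : X) : Pretrivialization (EuclideanSpace ℝ (Fin n))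
    (π (EuclideanSpace ℝ (Fin n)) V) where
  toFun p := (p.1, S.triv c p.1 p.2)
  invFun q := ⟨q.1, (S.triv c q.1).symm q.2⟩
  source := π (EuclideanSpace ℝ (Fin n)) V ⁻¹' S.baseSet c
  target := S.baseSet c ×ˢ univ
  map_source' _ hp := ⟨hp, mem_univ _⟩
  map_target' _ hq := hq.1
  left_inv' p _ := by simp
  right_inv' q _ := by simp
  open_target := (S.isOpen_baseSet c).prod isOpen_univ
  baseSet := S.baseSet c
  open_baseSet := S.isOpen_baseSet c
  source_eq := rfl
  target_eq := rfl
  proj_toFun _ _ := rfl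

/-- The transition functions of a local system. -/
noncomputable def transition (c c' y : X) :
    EuclideanSpace ℝ (Fin n) →L[ℝ] EuclideanSpace ℝ (Fin n) :=
  LinearMap.toContinuousLinearMap ((S.triv c' y).toLinearMap ∘ₗ (S.triv c y).symm.toLinearMap)

theorem contMDiffOn_transition (c c' : X) :
    ContMDiffOn (𝓡 d) 𝓘(ℝ, EuclideanSpace ℝ (Fin n) →L[ℝ] EuclideanSpace ℝ (Fin n)) ∞
      (S.transition c c') (S.baseSet c ∩ S.baseSet c') := by
  rintro y ⟨hy, hy'⟩
  refine ((contMDiffAt_const (c := S.transition c c' y)).congr_of_eventuallyEq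
    ?_).contMDiffWithinAt
  filter_upwards [S.eventually_transition_eq c c' y hy hy'] with z hz
  ext1 u
  exact hz u

theorem transition_apply {c c' y : X} (hy : y ∈ S.baseSet c) (u : EuclideanSpace ℝ (Fin n)) :
    S.transition c c' y u = (S.pretriv c' ⟨y, (S.pretriv c).symm y u⟩).2 := by
  rw [(S.pretriv c).mk_symm hy]
  rfl

variable [∀ y, TopologicalSpace (V y)] [∀ y, IsTopologicalAddGroup (V y)]
  [∀ y, ContinuousSMul ℝ (V y)] [∀ y, IsModuleTopology ℝ (V y)]

/-- The vector prebundle of a local system. -/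
noncomputable def prebundle (d : ℕ) [ChartedSpace (EuclideanSpace ℝ (Fin d)) X] :
    VectorPrebundle ℝ (EuclideanSpace ℝ (Fin n)) V where
  pretrivializationAtlas := range S.pretriv
  pretrivialization_linear' := by
    rintro _ ⟨c, rfl⟩
    exact ⟨fun y _ => ⟨fun a b => map_add (S.triv c y) a b, fun r a => map_smul (S.triv c y) r a⟩⟩
  pretrivializationAt := S.pretriv
  mem_base_pretrivializationAt := S.mem_baseSet
  pretrivialization_mem_atlas c := ⟨c, rfl⟩
  exists_coordChange := by
    rintro _ ⟨c, rfl⟩ _ ⟨c', rfl⟩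
    exact ⟨S.transition c c', (S.contMDiffOn_transition (d := d) c c').continuousOn,
      fun y hy u => S.transition_apply hy.1 u⟩
  totalSpaceMk_isInducing y := by
    let L : V y ≃L[ℝ] EuclideanSpace ℝ (Fin n) :=
      { S.triv y y with
        continuous_toFun := IsModuleTopology.continuous_of_linearMap (S.triv y y).toLinearMap
        continuous_invFun :=
          LinearMap.continuous_of_finiteDimensional (S.triv y y).symm.toLinearMap }
    exact (isEmbedding_prodMkRight y).isInducing.comp L.toHomeomorph.isInducing

theorem isContMDiff_prebundle : (S.prebundle d).IsContMDiff (𝓡 d) ∞ := by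
  refine ⟨?_⟩
  rintro _ ⟨c, rfl⟩ _ ⟨c', rfl⟩
  exact ⟨S.transition c c', S.contMDiffOn_transition (d := d) c c',
    fun y hy u => S.transition_apply hy.1 u⟩

variable [IsManifold (𝓡 d) ∞ X]

/-- The vector bundle whose preferred trivializations are those of a local system. -/
noncomputable def toSmoothVB (d : ℕ) [ChartedSpace (EuclideanSpace ℝ (Fin d)) X]
    [IsManifold (𝓡 d) ∞ X] : SmoothVB.{u, v} d X :=
  letI := (S.prebundle d).totalSpaceTopology
  letI := (S.prebundle d).toFiberBundle
  haveI := (S.prebundle d).toVectorBundle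
  haveI := S.isContMDiff_prebundle (d := d)
  { rank := n
    fiber := V
    smoothBundle := VectorPrebundle.contMDiffVectorBundle (IB := 𝓡 d) (n := ∞) (S.prebundle d) }

theorem coord_localTrivAt {c y : X} (hy : y ∈ S.baseSet c) (a : V y) :
    ((S.toSmoothVB d).localTrivAt c).coord y a = S.triv c y a :=
  SmoothVB.LocalTriv.ofTrivialization_coord_apply (S.toSmoothVB d) _ (y := y) hy a

theorem coord_localTrivAt_symm {c y : X} (hy : y ∈ S.baseSet c) (u : EuclideanSpace ℝ (Fin n)) :
    (((S.toSmoothVB d).localTrivAt c).coord y).symm u = (S.triv c y).symm u :=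
  (ContinuousLinearEquiv.symm_apply_eq _).2
    (((S.triv c y).apply_symm_apply u).symm.trans (S.coord_localTrivAt (d := d) hy _).symm)

theorem hasLocallyConstantTransitions : (S.toSmoothVB d).HasLocallyConstantTransitions := by
  have htransition {c c' z : X} (hz : z ∈ S.baseSet c) (hz' : z ∈ S.baseSet c')
      (u : EuclideanSpace ℝ (Fin n)) :
      ((S.toSmoothVB d).localTrivAt c').coord z
        ((((S.toSmoothVB d).localTrivAt c).coord z).symm u) = S.triv c' z ((S.triv c z).symm u) :=
    (congrArg (((S.toSmoothVB d).localTrivAt c').coord z)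
      (S.coord_localTrivAt_symm (d := d) hz u)).trans (S.coord_localTrivAt (d := d) hz' _)
  intro c c' y hy hy'
  filter_upwards [S.eventually_transition_eq c c' y hy hy', (S.isOpen_baseSet c).mem_nhds hy,
    (S.isOpen_baseSet c').mem_nhds hy'] with z hz hzc hzc' u
  exact (htransition hzc hzc' u).trans ((hz u).trans (htransition hy hy' u).symm)

/-- The flat vector bundle of a local system. -/
noncomputable def toFlatVB (d : ℕ) [ChartedSpace (EuclideanSpace ℝ (Fin d)) X]
    [IsManifold (𝓡 d) ∞ X] : FlatVB.{u, v} d X :=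
  (S.hasLocallyConstantTransitions (d := d)).toFlatVB

theorem isMorphism_localSystem_toFlatVB [T2Space X] :
    S.IsMorphism (S.toFlatVB d).localSystem fun _ => LinearMap.id := by
  intro c c' y hy hy'
  have hid := FlatVB.eventually_forall_coord_hom_eq (𝟙 (S.toFlatVB d))
    ((S.hasLocallyConstantTransitions (d := d)).isFlatTriv_localTrivAt c)
    ((S.toFlatVB d).isFlatTriv_flatTriv c') hy hy'
  have hsymm {z : X} (hz : z ∈ S.baseSet c) (u : EuclideanSpace ℝ (Fin n)) :
      ((S.toFlatVB d).flatTriv c').coord z ((S.triv c z).symm u) =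
        ((S.toFlatVB d).flatTriv c').coord z
          ((((S.toSmoothVB d).localTrivAt c).coord z).symm u) :=
    congrArg (((S.toFlatVB d).flatTriv c').coord z) (S.coord_localTrivAt_symm (d := d) hz u).symm
  filter_upwards [hid, (S.isOpen_baseSet c).mem_nhds hy] with z hz hzc u
  exact (hsymm hzc u).trans ((hz u).trans (hsymm hy u).symm)

theorem transport_toFlatVB [T2Space X] {y z : X} (γ : Path.Homotopic.Quotient y z) (a : V y) :
    (S.toFlatVB d).localSystem.transport.map γ a = S.transport.map γ a :=
  (S.isMorphism_localSystem_toFlatVB.isNatural γ a).symm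

end LocalSystem

/-! ### The monodromy functor -/

section FiniteModules

variable {R : Type u} [CommRing R] {G : Type*} [Monoid G]

/-- The representation of `G` on the underlying module of an object of `Rep(G, FGModuleCat R)`. The
library's `FDRep` does not apply, as it ties the universe of the modules to that of `G`. -/
def actionRepresentation (A : Action (FGModuleCat.{v} R) G) : Representation R G A.V where
  toFun g := (A.ρ g).hom.hom
  map_one' := congrArg (fun f => f.hom.hom) A.ρ.map_one
  map_mul' g h := congrArg (fun f => f.hom.hom) (A.ρ.map_mul g h)

/-- The object of `Rep(G, FGModuleCat R)` given by a representation on a finite module. -/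
def actionOfRepresentation {V : Type v} [AddCommGroup V] [Module R V] [Module.Finite R V]
    (ρ : Representation R G V) : Action (FGModuleCat.{v} R) G where
  V := FGModuleCat.of R V
  ρ :=
    { toFun g := FGModuleCat.ofHom (ρ g)
      map_one' := FGModuleCat.hom_ext ρ.map_one
      map_mul' g h := FGModuleCat.hom_ext (ρ.map_mul g h) }

variable {A B : Action (FGModuleCat.{v} R) G}

theorem isIntertwiningMap_actionHom (f : A ⟶ B) :
    (actionRepresentation A).IsIntertwiningMap (actionRepresentation B) f.hom.hom.hom where
  isIntertwining g := LinearMap.congr_fun (congrArg (fun f => f.hom.hom) (f.comm g))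

/-- The morphism of `Rep(G, FGModuleCat R)` given by an intertwining linear map. -/
def actionHomOfIsIntertwiningMap {f : A.V →ₗ[R] B.V}
    (hf : (actionRepresentation A).IsIntertwiningMap (actionRepresentation B) f) : A ⟶ B where
  hom := FGModuleCat.ofHom f
  comm g := FGModuleCat.hom_ext (LinearMap.ext (hf.isIntertwining g))

/-- The isomorphism of `Rep(G, FGModuleCat R)` given by an intertwining linear isomorphism. -/
def actionIsoOfIsIntertwiningMap {e : A.V ≃ₗ[R] B.V}
    (he : (actionRepresentation A).IsIntertwiningMap (actionRepresentation B) e.toLinearMap) :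
    A ≅ B :=
  Action.mkIso e.toFGModuleCatIso fun g => FGModuleCat.hom_ext (LinearMap.ext (he.isIntertwining g))

end FiniteModules

theorem exists_isOpen_isSimplyConnected {E : Type*} [NormedAddCommGroup E] [NormedSpace ℝ E]
    {X : Type*} [TopologicalSpace X] [ChartedSpace E X] (c : X) :
    ∃ U : Set X, IsOpen U ∧ c ∈ U ∧ IsSimplyConnected U := by
  let e := chartAt E c
  obtain ⟨r, hr, hball⟩ := Metric.isOpen_iff.1 e.open_target (e c) (mem_chart_target E c)
  refine ⟨e.symm '' Metric.ball (e c) r,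
    e.symm.isOpen_image_of_subset_source Metric.isOpen_ball hball,
    ⟨e c, Metric.mem_ball_self hr, e.left_inv (mem_chart_source E c)⟩, ?_⟩
  have := Metric.contractibleSpace_ball (x := e c) hr
  have := (e.symm.homeomorphOfImageSubsetSource hball rfl).symm.contractibleSpace
  exact inferInstanceAs (SimplyConnectedSpace _)

theorem pathConnectedSpace_of_chartedSpace (E : Type*) [NormedAddCommGroup E] [NormedSpace ℝ E]
    (X : Type*) [TopologicalSpace X] [ChartedSpace E X] [ConnectedSpace X] :
    PathConnectedSpace X := by
  have := ChartedSpace.locallyPathConnectedSpace E X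
  exact pathConnectedSpace_iff_connectedSpace.2 inferInstance

variable {d : ℕ} {X : Type u} [TopologicalSpace X]
    [ChartedSpace (EuclideanSpace ℝ (Fin d)) X] [IsManifold (𝓡 d) ∞ X]

instance (E : SmoothVB.{u, v} d X) (y : X) : Module.Finite ℝ (E.fiber y) :=
  .equiv (E.fiberEquiv y).symm.toLinearEquiv

namespace FlatVB

variable [T2Space X]

theorem exists_isNatural_transport {W : Type v} [AddCommGroup W] [Module ℝ W] [Module.Finite ℝ W]
    (P : PathTransport ℝ (fun _ : X => W)) :
    ∃ (E : FlatVB.{u, v} d X) (f : ∀ y, E.bundle.fiber y ≃ₗ[ℝ] W),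
      E.localSystem.transport.IsNatural P fun y => (f y).toLinearMap := by
  have := ChartedSpace.locallyPathConnectedSpace (EuclideanSpace ℝ (Fin d)) X
  choose U hU hmem hsc using
    exists_isOpen_isSimplyConnected (E := EuclideanSpace ℝ (Fin d)) (X := X)
  have L : W ≃ₗ[ℝ] EuclideanSpace ℝ (Fin (Module.finrank ℝ W)) :=
    LinearEquiv.ofFinrankEq _ _ finrank_euclideanSpace_fin.symm
  let : TopologicalSpace W := moduleTopology ℝ W
  have : IsModuleTopology ℝ W := ⟨rfl⟩
  have : IsTopologicalAddGroup W := IsModuleTopology.topologicalAddGroup ℝ W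
  have : ContinuousSMul ℝ W := IsModuleTopology.toContinuousSMul ℝ W
  let S := P.localSystem (fun _ => L) hmem hsc hU
  exact ⟨S.toFlatVB d, fun _ => LinearEquiv.refl ℝ W, fun _ _ γ a =>
    (S.transport_toFlatVB γ a).trans (P.transport_localSystem (fun _ => L) hmem hsc hU γ a)⟩

variable (x : X)

variable (d X) in
/-- The monodromy functor at `x`: it sends a flat vector bundle to the holonomy representation of
its local system of parallel sections on the fibre over `x`. -/
noncomputable def monodromy :
    FlatVB.{u, v} d X ⥤ Action (FGModuleCat.{v} ℝ) (FundamentalGroup X x) where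
  obj E := actionOfRepresentation (E.localSystem.transport.holonomy x)
  map φ := actionHomOfIsIntertwiningMap ((isMorphism_hom φ).isNatural.isIntertwiningMap x)
  map_id _ := rfl
  map_comp _ _ := rfl

variable [ConnectedSpace X]

instance : (monodromy.{u, v} d X x).Faithful where
  map_injective {E E'} φ ψ h := by
    have := pathConnectedSpace_of_chartedSpace (EuclideanSpace ℝ (Fin d)) X
    have hφψ := (isMorphism_hom φ).isNatural.ext (isMorphism_hom ψ).isNatural (x := x)
      (congrArg (fun f => f.hom.hom.hom) h)
    exact FlatVB.Hom.ext (SmoothVB.Hom.ext (funext fun y =>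
      ContinuousLinearMap.coe_injective (congrFun hφψ y)))

instance : (monodromy.{u, v} d X x).Full where
  map_surjective {E E'} f := by
    have := ChartedSpace.locallyPathConnectedSpace (EuclideanSpace ℝ (Fin d)) X
    have := pathConnectedSpace_of_chartedSpace (EuclideanSpace ℝ (Fin d)) X
    obtain ⟨φ, hφ, hφx⟩ :=
      PathTransport.exists_isNatural_of_isIntertwiningMap (P := E.localSystem.transport)
        (P' := E'.localSystem.transport) (isIntertwiningMap_actionHom f)
    exact ⟨homOfIsMorphism φ (LocalSystem.isMorphism_of_isNatural hφ),
      Action.hom_ext _ _ (FGModuleCat.hom_ext hφx)⟩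

instance : (monodromy.{u, v} d X x).EssSurj where
  mem_essImage A := by
    have := pathConnectedSpace_of_chartedSpace (EuclideanSpace ℝ (Fin d)) X
    let p (y : X) : Path.Homotopic.Quotient x y := .mk (PathConnectedSpace.somePath x y)
    let ρ := actionRepresentation A
    obtain ⟨E, f, hf⟩ := exists_isNatural_transport (d := d) (PathTransport.ofRepresentation ρ p)
    let A' := actionOfRepresentation ((PathTransport.ofRepresentation ρ p).holonomy x)
    let e : (monodromy d X x).obj E ≅ A' :=
      actionIsoOfIsIntertwiningMap (B := A') (e := f x) (hf.isIntertwiningMap x)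
    let e' : A' ≅ A := Action.mkIso (A.ρAut (FundamentalGroup.fromPath (p x))) fun g =>
      FGModuleCat.hom_ext (LinearMap.ext
        ((PathTransport.isIntertwiningMap_ofRepresentation ρ p).isIntertwining g))
    exact ⟨E, ⟨e ≪≫ e'⟩⟩

instance : (monodromy.{u, v} d X x).IsEquivalence where

end FlatVB

/-! ### Functoriality of quiver representations -/

namespace QuiverRep

variable {Q : Type w} [Quiver.{w'} Q] {C : Type*} [Category* C] {D : Type*} [Category* D]

/-- The functor `Rep(Q, C) ⥤ Rep(Q, D)` induced by a functor `C ⥤ D`, applied at every vertex and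
every arrow. -/
def mapFunctor (Q : Type w) [Quiver.{w'} Q] (F : C ⥤ D) : QuiverRep Q C ⥤ QuiverRep Q D where
  obj V := { obj i := F.obj (V.obj i), map a := F.map (V.map a) }
  map f :=
    { app i := F.map (f.app i)
      comm a := by rw [← F.map_comp, f.comm, F.map_comp] }
  map_id _ := Hom.ext (funext fun _ => F.map_id _)
  map_comp _ _ := Hom.ext (funext fun _ => F.map_comp _ _)

/-- An isomorphism of quiver representations given by isomorphisms at the vertices. -/
def isoMk {V W : QuiverRep Q C} (e : ∀ i, V.obj i ≅ W.obj i)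
    (h : ∀ {i j : Q} (a : i ⟶ j), V.map a ≫ (e j).hom = (e i).hom ≫ W.map a) : V ≅ W where
  hom := { app i := (e i).hom, comm := h }
  inv :=
    { app i := (e i).inv
      comm {i j} a := by rw [Iso.comp_inv_eq, Category.assoc, h, Iso.inv_hom_id_assoc] }
  hom_inv_id := Hom.ext (funext fun i => (e i).hom_inv_id)
  inv_hom_id := Hom.ext (funext fun i => (e i).inv_hom_id)

instance (F : C ⥤ D) [F.Faithful] : (mapFunctor Q F).Faithful where
  map_injective h := Hom.ext (funext fun i => F.map_injective (congrFun (congrArg Hom.app h) i))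

instance (F : C ⥤ D) [F.Full] [F.Faithful] : (mapFunctor Q F).Full where
  map_surjective {V W} f := by
    let g (i : Q) : F.obj (V.obj i) ⟶ F.obj (W.obj i) := f.app i
    have hg {i j : Q} (a : i ⟶ j) : F.map (V.map a) ≫ g j = g i ≫ F.map (W.map a) := f.comm a
    refine ⟨{ app i := F.preimage (g i), comm a := F.map_injective ?_ },
      Hom.ext (funext fun i => F.map_preimage (g i))⟩
    rw [F.map_comp, F.map_comp, F.map_preimage, F.map_preimage, hg]

instance (F : C ⥤ D) [F.Full] [F.EssSurj] : (mapFunctor Q F).EssSurj where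
  mem_essImage W := by
    let e (i : Q) : F.obj (F.objPreimage (W.obj i)) ≅ W.obj i := F.objObjPreimageIso (W.obj i)
    let V : QuiverRep Q C :=
      { obj i := F.objPreimage (W.obj i)
        map {i j} a := F.preimage ((e i).hom ≫ W.map a ≫ (e j).inv) }
    refine ⟨V, ⟨isoMk e fun {i j} a => ?_⟩⟩
    calc F.map (V.map a) ≫ (e j).hom
        = ((e i).hom ≫ W.map a ≫ (e j).inv) ≫ (e j).hom :=
          congrArg (· ≫ (e j).hom) (F.map_preimage _)
      _ = (e i).hom ≫ W.map a := by
          rw [Category.assoc, Category.assoc, Iso.inv_hom_id, Category.comp_id]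

instance (F : C ⥤ D) [F.IsEquivalence] : (mapFunctor Q F).IsEquivalence where

/-- The equivalence exchanging the action of a monoid `G` with the structure of a representation of
the quiver `Q`. -/
def actionEquivalence (Q : Type w) [Quiver.{w'} Q] (C : Type*) [Category* C] (G : Type*)
    [Monoid G] : QuiverRep Q (Action C G) ≌ Action (QuiverRep Q C) G where
  functor :=
    { obj V :=
        { V := { obj i := (V.obj i).V, map a := (V.map a).hom }
          ρ :=
            { toFun g := { app i := (V.obj i).ρ g, comm a := ((V.map a).comm g).symm }
              map_one' := Hom.ext (funext fun i => (V.obj i).ρ.map_one)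
              map_mul' g h := Hom.ext (funext fun i => (V.obj i).ρ.map_mul g h) } }
      map f :=
        { hom := { app i := (f.app i).hom, comm a := congrArg Action.Hom.hom (f.comm a) }
          comm g := Hom.ext (funext fun i => (f.app i).comm g) } }
  inverse :=
    { obj A :=
        { obj i :=
            { V := A.V.obj i
              ρ :=
                { toFun g := (A.ρ g).app i
                  map_one' := congrFun (congrArg Hom.app A.ρ.map_one) i
                  map_mul' g h := congrFun (congrArg Hom.app (A.ρ.map_mul g h)) i } }
          map a := { hom := A.V.map a, comm g := ((A.ρ g).comm a).symm } }
      map f :=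
        { app i := { hom := f.hom.app i, comm g := congrFun (congrArg Hom.app (f.comm g)) i }
          comm a := Action.hom_ext _ _ (f.hom.comm a) } }
  unitIso := Iso.refl _
  counitIso := Iso.refl _
  functor_unitIso_comp _ := Action.hom_ext _ _ (Hom.ext (funext fun _ => Category.comp_id _))

end QuiverRep

theorem mainTheorem8_general {d : ℕ} {X : Type u} [TopologicalSpace X]
    [ChartedSpace (EuclideanSpace ℝ (Fin d)) X] [IsManifold (𝓡 d) ∞ X]
    [T2Space X] [ConnectedSpace X] (x : X) (Q : Type w) [Quiver.{w'} Q] :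
    Nonempty (QuiverRep Q (FlatVB.{u, v} d X) ≌
      Action (QuiverRep Q (FGModuleCat.{v} ℝ)) (FundamentalGroup X x)) :=
  ⟨(QuiverRep.mapFunctor Q (FlatVB.monodromy.{u, v} d X x)).asEquivalence.trans
    (QuiverRep.actionEquivalence Q (FGModuleCat.{v} ℝ) (FundamentalGroup X x))⟩

theorem mainTheorem8 {d : ℕ} {X : Type u} [TopologicalSpace X]
    [ChartedSpace (EuclideanSpace ℝ (Fin d)) X] [IsManifold (𝓡 d) ∞ X]
    [T2Space X] [SecondCountableTopology X] [ConnectedSpace X] (x : X)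
    (Q : Type w) [Quiver.{w'} Q] [Finite Q] [∀ i j : Q, Finite (i ⟶ j)] :
    Nonempty (QuiverRep Q (FlatVB.{u, v} d X) ≌
      Action (QuiverRep Q (FGModuleCat.{v} ℝ)) (FundamentalGroup X x)) :=
  mainTheorem8_general x Q
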